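/- Write $\mathrm{PSL}(2,\mathbf R)=\mathrm{SL}(2,\mathbf R)/\{\pm I\}$. A subgroup of $\mathrm{PSL}(2,\mathbf R)$ is called non-elementary if it has no finite orbit in the closed hyperbolic plane $\mathbb H\cup\partial_\infty\mathbb H$. A procedure is understood as a Blum--Shub--Smale machine over the ordered field $\mathbf R$: a finite flow chart acting on finitely many real registers by exact arithmetic operations with rational constants, and branching on tests $t\ge 0$. Theorem. There is a single Blum--Shub--Smale machine, with answers "discrete" and "not discrete", that takes as input the twelve entries of three matrices in $\mathrm{SL}(2,\mathbf R)$ and has the following properties. Let $A,B,C$ be parabolic elements of $\mathrm{PSL}(2,\mathbf R)$ such that $\Gamma=\langle A,B,C\rangle$ is non-elementary and free of rank three, and give the machine any matrices representing $A,B,C$. Then: 1. The machine determines whether or not $\Gamma$ is discrete: every answer that it gives is correct, and if $\Gamma$ is not discrete, then it halts with the answer "not discrete". 2. If $\Gamma$ has no elliptic elements, then the machine halts after finitely many steps (so on such inputs the procedure is an algorithm). -/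

import Mathlib

open scoped MatrixGroups

/-! ### Subgroups of `PSL(2, ℝ)` -/

/-- An element of `PSL(2, ℝ)` is parabolic if a matrix representing it is (equivalently, it is not
the identity and `|tr| = 2`). Since `Matrix.IsParabolic` is invariant under `m ↦ -m`, it does not
matter which of the two representing matrices is used. -/
def PSLParabolic (g : PSL(2, ℝ)) : Prop :=
  ∃ m : SL(2, ℝ), (m : PSL(2, ℝ)) = g ∧ (m : Matrix (Fin 2) (Fin 2) ℝ).IsParabolic

/-- An element of `PSL(2, ℝ)` is elliptic if a matrix representing it is (that is, `|tr| < 2`). -/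
def PSLElliptic (g : PSL(2, ℝ)) : Prop :=
  ∃ m : SL(2, ℝ), (m : PSL(2, ℝ)) = g ∧ (m : Matrix (Fin 2) (Fin 2) ℝ).IsElliptic

/-- The orbit of a point of the upper half plane under a subgroup of `PSL(2, ℝ)`. -/
def orbitInUpperHalfPlane (Γ : Subgroup PSL(2, ℝ)) (z : UpperHalfPlane) : Set UpperHalfPlane :=
  {w | ∃ m : SL(2, ℝ), (m : PSL(2, ℝ)) ∈ Γ ∧ m • z = w}

/-- The orbit of a point of the boundary circle (the real projective line) under a subgroup of
`PSL(2, ℝ)`. -/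
def orbitInBoundary (Γ : Subgroup PSL(2, ℝ)) (p : Projectivization ℝ (Fin 2 → ℝ)) :
    Set (Projectivization ℝ (Fin 2 → ℝ)) :=
  {q | ∃ g : PSL(2, ℝ), g ∈ Γ ∧ g • p = q}

/-- A subgroup of `PSL(2, ℝ)` is non-elementary if it has no finite orbit in the closed hyperbolic
plane, i.e. neither in the upper half plane nor in its boundary circle. -/
def PSLNonElementary (Γ : Subgroup PSL(2, ℝ)) : Prop :=
  (∀ z, (orbitInUpperHalfPlane Γ z).Infinite) ∧ ∀ p, (orbitInBoundary Γ p).Infinite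

/-! ### Blum–Shub–Smale machines over `ℝ` -/

/-- Arithmetic terms with rational constants in the variables `R`. -/
inductive ArithTerm (R : Type) : Type
  | var (r : R) : ArithTerm R
  | const (q : ℚ) : ArithTerm R
  | add (s t : ArithTerm R) : ArithTerm R
  | sub (s t : ArithTerm R) : ArithTerm R
  | mul (s t : ArithTerm R) : ArithTerm R
  | div (s t : ArithTerm R) : ArithTerm R

/-- The real value of a term (division by zero gives zero). -/
noncomputable def ArithTerm.eval {R : Type} (v : R → ℝ) : ArithTerm R → ℝ
  | .var r => v r
  | .const q => (q : ℝ)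
  | .add s t => s.eval v + t.eval v
  | .sub s t => s.eval v - t.eval v
  | .mul s t => s.eval v * t.eval v
  | .div s t => s.eval v / t.eval v

/-- The instruction carried by a node of a machine with registers `R` and nodes `N`: a computation
node simultaneously assigns to every register `r` the value of the term `f r`; a branch node tests
whether the value of `t` is nonnegative; a halting node stops with an answer. -/
inductive BSSInstr (R N : Type) : Type
  | compute (f : R → ArithTerm R) (next : N) : BSSInstr R N
  | branch (t : ArithTerm R) (ifNonneg ifNeg : N) : BSSInstr R N
  | halt (answer : Bool) : BSSInstr R N

/-- A (finite-dimensional) Blum–Shub–Smale machine over the ordered field `ℝ` with rational machine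
constants and yes/no answers: a finite flow chart acting on finitely many registers, each of which
holds a real number. The registers are the input registers, indexed by `ι`, and finitely many
work registers. -/
structure BSSMachine (ι : Type) where
  Work : Type
  finite_work : Finite Work
  Node : Type
  finite_node : Finite Node
  start : Node
  instr : Node → BSSInstr (ι ⊕ Work) Node

namespace BSSMachine

variable {ι : Type} (M : BSSMachine ι)

/-- A configuration: the current node and the contents of the registers. -/
abbrev Config : Type := M.Node × (ι ⊕ M.Work → ℝ)

/-- One step of the machine; a halted machine stays where it is. -/
noncomputable def step (c : M.Config) : M.Config :=
  match M.instr c.1 with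
  | .compute f next => (next, fun r => (f r).eval c.2)
  | .branch t ifNonneg ifNeg =>
      open scoped Classical in
      if 0 ≤ t.eval c.2 then (ifNonneg, c.2) else (ifNeg, c.2)
  | .halt _ => c

/-- The initial configuration: the work registers hold `0`. -/
def init (x : ι → ℝ) : M.Config := (M.start, Sum.elim x fun _ => 0)

/-- On input `x`, the machine halts after finitely many steps with the given answer. -/
def HaltsWith (x : ι → ℝ) (answer : Bool) : Prop :=
  ∃ n : ℕ, M.instr (M.step^[n] (M.init x)).1 = .halt answer

/-- On input `x`, the machine halts after finitely many steps. -/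
def Halts (x : ι → ℝ) : Prop := ∃ answer, M.HaltsWith x answer

end BSSMachine

/-- The twelve entries of three real `2 × 2` matrices of determinant `1`. -/
def matrixEntries (a b c : SL(2, ℝ)) : Fin 3 × Fin 2 × Fin 2 → ℝ :=
  fun p => (![a, b, c] p.1 : Matrix (Fin 2) (Fin 2) ℝ) p.2.1 p.2.2

/-! Up to inversion and sign, a parabolic element is a transvection `T_v : w ↦ w + ω(v, w) v`. Let
`u`, `v`, `w` be the vectors of the three generators, with pairings `a = ω(u, v)`, `b = ω(v, w)`, `c
= ω(u, w)`. The machine stores `x = a²`, `y = b²`, `z = c²`, `t = |abc|`, which are traces of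
products of nilpotent parts up to sign, so no square roots are needed. Put `K = x + y + z - t`.

Each pass either decides or descends. If `K ≤ 0` and `x, y, z > 0`, ping-pong with three half-planes
shows that `Γ` is discrete (`HasTriple.discreteTopology`). If one of `x`, `y`, `z` is below `4`, if
`0 < K < 4`, or if one of `|t - y - z|`, `|t - x - z|`, `|t - x - y|` is below `2`, an explicit word
is elliptic. A free group is torsion-free, so that word has infinite order and `Γ` is not discrete
(`not_discreteTopology_of_elliptic`).

In the remaining case a Markov-type move `|b| ↦ ||b| - |a||c||`, or one of its two analogues, keeps
the group and lowers `t` by at least `8` (`HasTriple.reducible`, `reduce_le`). As `t ≥ 0`, the loop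
ends for every free `Γ`. -/

/-! ### Transvections of the real plane -/

/-- The standard symplectic form on `ℝ²`. -/
def symp (v w : Fin 2 → ℝ) : ℝ := v 0 * w 1 - v 1 * w 0

/-- The transvection `w ↦ w + s ω(v, w) v`. -/
def transv (s : ℝ) (v : Fin 2 → ℝ) : SL(2, ℝ) :=
  ⟨!![1 - s * (v 0 * v 1), s * v 0 ^ 2; -(s * v 1 ^ 2), 1 + s * (v 0 * v 1)], by
    rw [Matrix.det_fin_two_of]; ring⟩

/-- The action of `SL(2, ℝ)` on `ℝ²`. -/
def act (g : SL(2, ℝ)) (w : Fin 2 → ℝ) : Fin 2 → ℝ :=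
  ![g 0 0 * w 0 + g 0 1 * w 1, g 1 0 * w 0 + g 1 1 * w 1]

@[simp] lemma act_zero (g : SL(2, ℝ)) (w : Fin 2 → ℝ) :
    act g w 0 = g 0 0 * w 0 + g 0 1 * w 1 := rfl

@[simp] lemma act_one (g : SL(2, ℝ)) (w : Fin 2 → ℝ) :
    act g w 1 = g 1 0 * w 0 + g 1 1 * w 1 := rfl

lemma SL2_mul_apply (g h : SL(2, ℝ)) (i j : Fin 2) :
    (g * h) i j = g i 0 * h 0 j + g i 1 * h 1 j := by
  rw [Matrix.SpecialLinearGroup.coe_mul, Matrix.mul_apply, Fin.sum_univ_two]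

@[simp] lemma transv_00 (s : ℝ) (v) : transv s v 0 0 = 1 - s * (v 0 * v 1) := rfl
@[simp] lemma transv_01 (s : ℝ) (v) : transv s v 0 1 = s * v 0 ^ 2 := rfl
@[simp] lemma transv_10 (s : ℝ) (v) : transv s v 1 0 = -(s * v 1 ^ 2) := rfl
@[simp] lemma transv_11 (s : ℝ) (v) : transv s v 1 1 = 1 + s * (v 0 * v 1) := rfl

lemma SL2_ext {g h : SL(2, ℝ)} (h00 : g 0 0 = h 0 0) (h01 : g 0 1 = h 0 1)
    (h10 : g 1 0 = h 1 0) (h11 : g 1 1 = h 1 1) : g = h := by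
  ext i j
  fin_cases i <;> fin_cases j <;> assumption

lemma SL2_det (g : SL(2, ℝ)) : g 0 0 * g 1 1 - g 0 1 * g 1 0 = 1 := by
  have := g.2
  rwa [Matrix.det_fin_two] at this

lemma act_mul (g h : SL(2, ℝ)) (w : Fin 2 → ℝ) : act (g * h) w = act g (act h w) := by
  ext i; fin_cases i <;> simp [SL2_mul_apply] <;> ring

lemma act_id (w : Fin 2 → ℝ) : act 1 w = w := by
  ext i; fin_cases i <;> simp

lemma act_transv (s : ℝ) (v w : Fin 2 → ℝ) :
    act (transv s v) w = w + (s * symp v w) • v := by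
  ext i; fin_cases i <;> simp [symp] <;> ring

lemma transv_mul (s t : ℝ) (v : Fin 2 → ℝ) :
    transv s v * transv t v = transv (s + t) v := by
  apply SL2_ext <;> simp [SL2_mul_apply] <;> ring

lemma transv_zero (v : Fin 2 → ℝ) : transv 0 v = 1 := by
  apply SL2_ext <;> simp

lemma transv_inv (s : ℝ) (v : Fin 2 → ℝ) : (transv s v)⁻¹ = transv (-s) v :=
  inv_eq_of_mul_eq_one_right (by rw [transv_mul, add_neg_cancel, transv_zero])

lemma transv_conj (g : SL(2, ℝ)) (s : ℝ) (v : Fin 2 → ℝ) :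
    g * transv s v * g⁻¹ = transv s (act g v) := by
  rw [mul_inv_eq_iff_eq_mul]
  have hd := SL2_det g
  apply SL2_ext
  · simp only [SL2_mul_apply, transv_00, transv_01, transv_10, act_zero, act_one]
    linear_combination (s * v 0 * v 1 * g 0 0 + s * v 1 ^ 2 * g 0 1) * hd
  · simp only [SL2_mul_apply, transv_00, transv_01, transv_11, act_zero, act_one]
    linear_combination (-s * v 0 ^ 2 * g 0 0 - s * v 0 * v 1 * g 0 1) * hd
  · simp only [SL2_mul_apply, transv_00, transv_10, transv_11, act_zero, act_one]
    linear_combination (s * v 0 * v 1 * g 1 0 + s * v 1 ^ 2 * g 1 1) * hd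
  · simp only [SL2_mul_apply, transv_01, transv_10, transv_11, act_zero, act_one]
    linear_combination (-s * v 0 ^ 2 * g 1 0 - s * v 0 * v 1 * g 1 1) * hd

lemma transv_neg (s : ℝ) (v : Fin 2 → ℝ) : transv s (-v) = transv s v := by
  apply SL2_ext <;> simp

/-! ### Ping-pong -/

/-- Products of powers of transvections along `v i` in which each power acts nontrivially on a
fundamental domain, measured by functionals `Φ i`. -/
inductive PingPong {ι : Type} (v : ι → Fin 2 → ℝ) (Φ : ι → SL(2, ℝ) → ℝ) : SL(2, ℝ) → Prop
  | one : PingPong v Φ 1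
  | step (i : ι) (n : ℤ) (g : SL(2, ℝ)) (hn : n ≠ 0) (hg : PingPong v Φ g) (hΦ : 0 < Φ i g) :
      PingPong v Φ (transv n (v i) * g)

/-- The functionals live on the group and play the role of half-planes: `Φ i < 0` is the region into
which nontrivial powers of the `i`-th generator push its complement, and these regions are disjoint.
The last syllable of a reduced word decides which region is reached. -/
lemma closure_pingPong {ι : Type} (v : ι → Fin 2 → ℝ) (Φ : ι → SL(2, ℝ) → ℝ)
    (h1 : ∀ i, 0 < Φ i 1)
    (hT : ∀ i (n : ℤ) g, n ≠ 0 → 0 < Φ i g → Φ i (transv n (v i) * g) < 0)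
    (hne : ∀ i j, i ≠ j → ∀ g, Φ i g < 0 → 0 < Φ j g)
    (g : SL(2, ℝ)) (hg : g ∈ Subgroup.closure (Set.range fun i => transv 1 (v i))) :
    g = 1 ∨ ∃ i, Φ i g < 0 := by
  have key : ∀ (j : ι) (m : ℤ) (g), m ≠ 0 → PingPong v Φ g →
      PingPong v Φ (transv m (v j) * g) := by
    intro j m g hm hg
    cases hg with
    | one => exact .step j m 1 hm .one (h1 j)
    | step i n g hn hg hΦ =>
      -- For equal letters the exponents merge, and the positivity already known for the tail `g`
      -- can be reused.
      by_cases hij : i = j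
      · subst hij
        rw [← mul_assoc, transv_mul]
        by_cases h0 : m + n = 0
        · have : (m : ℝ) + n = 0 := by exact_mod_cast h0
          rwa [this, transv_zero, one_mul]
        · have := PingPong.step i (m + n) g h0 hg hΦ
          rwa [Int.cast_add] at this
      · exact .step j m _ hm (.step i n g hn hg hΦ) (hne i j hij _ (hT i n g hn hΦ))
  have hP : PingPong v Φ g := by
    induction hg using Subgroup.closure_induction_left with
    | one => exact .one
    | mul_left x hx y _ ih =>
      obtain ⟨i, rfl⟩ := hx
      simpa using key i 1 y one_ne_zero ih
    | inv_mul_cancel x hx y _ ih =>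
      obtain ⟨i, rfl⟩ := hx
      simpa [transv_inv] using key i (-1) y (by norm_num) ih
  cases hP with
  | one => exact .inl rfl
  | step i n g hn hg hΦ => exact .inr ⟨i, hT i n g hn hΦ⟩

/-- An ideal arc based at `v`, with end points `e` and its image under the transvection, is moved
off itself by nontrivial powers. -/
lemma pingPong_arc {M L p : ℝ} (hC : p ^ 2 ≤ L * M) (hM : 0 ≤ M) (hL : 0 ≤ L) (hp : L < p) (n : ℤ)
    (hn : n ≠ 0) : (p + n * M) - (L + 2 * n * p + n ^ 2 * M) < 0 := by
  have hp0 : 0 < p := hL.trans_lt hp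
  have hM0 : 0 < M := by
    rcases hM.eq_or_lt with h | h
    · subst h; nlinarith
    · exact h
  have hpM : p < M := by nlinarith
  -- After multiplication by `M`, Cauchy–Schwarz replaces `L * M` by `p ^ 2` and the expression
  -- factors. Since `0 < p < M`, the two factors have opposite signs for every `n ≠ 0`.
  have : M * ((p + n * M) - (L + 2 * n * p + n ^ 2 * M)) ≤ (p + n * M) * (M - p - n * M) := by
    nlinarith
  have h2 : (p + n * M) * (M - p - n * M) < 0 := by
    rcases lt_or_gt_of_ne hn with h | h
    · have : (n : ℝ) ≤ -1 := by exact_mod_cast Int.le_sub_one_of_lt h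
      apply mul_neg_of_neg_of_pos <;> nlinarith
    · have : (1 : ℝ) ≤ n := by exact_mod_cast h
      apply mul_neg_of_pos_of_neg <;> nlinarith
  nlinarith

/-- The quadratic form cutting out the arc from `e` to its image under `transv 1 v`. -/
def arcForm (e v w : Fin 2 → ℝ) : ℝ := symp e w * (symp e v * symp v w - symp e w)

/-- The arc form averaged over three base vectors. -/
def arcSum (e v : Fin 2 → ℝ) (b : Fin 3 → Fin 2 → ℝ) (g : SL(2, ℝ)) : ℝ :=
  ∑ k, arcForm e v (act g (b k))

/-- One has `arcForm e v w = -ω(e, w) ω(T_v e, w)`: it vanishes at `e` and `T_v e` and is negative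
on the side of `v` when `ω(e, v) ≠ 0`. Summing over spanning base vectors evaluates it at a point of
the hyperbolic plane, so the sign tells the side of a geodesic. Applying `T_v ^ n` changes `l` to `l
+ n m` and fixes `m`. -/
lemma arcSum_transv (e v : Fin 2 → ℝ) (b : Fin 3 → Fin 2 → ℝ) (n : ℤ) (g : SL(2, ℝ))
    (hn : n ≠ 0) (hg : 0 < arcSum e v b g) : arcSum e v b (transv n v * g) < 0 := by
  set l : Fin 3 → ℝ := fun k => symp e (act g (b k))
  set m : Fin 3 → ℝ := fun k => symp e v * symp v (act g (b k))
  have e0 : arcSum e v b g = (∑ k, l k * m k) - ∑ k, l k ^ 2 := by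
    rw [← Finset.sum_sub_distrib]
    exact Finset.sum_congr rfl fun k _ => by simp only [arcForm, l, m]; ring
  have e1 : arcSum e v b (transv n v * g) = ((∑ k, l k * m k) + n * ∑ k, m k ^ 2) -
      ((∑ k, l k ^ 2) + 2 * n * (∑ k, l k * m k) + n ^ 2 * ∑ k, m k ^ 2) := by
    simp only [Finset.mul_sum, ← Finset.sum_add_distrib, ← Finset.sum_sub_distrib]
    refine Finset.sum_congr rfl fun k _ => ?_
    simp only [act_mul, act_transv, arcForm, l, m]
    simp only [symp, Pi.add_apply, Pi.smul_apply, smul_eq_mul]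
    ring
  rw [e1]
  refine pingPong_arc (Finset.sum_mul_sq_le_sq_mul_sq _ _ _)
    (Finset.sum_nonneg fun _ _ => sq_nonneg _) (Finset.sum_nonneg fun _ _ => sq_nonneg _) ?_ n hn
  linarith

/-! ### A criterion for discreteness -/

lemma symp_self (v : Fin 2 → ℝ) : symp v v = 0 := by simp [symp]; ring
lemma symp_swap (v w : Fin 2 → ℝ) : symp w v = -symp v w := by simp [symp]; ring
lemma symp_add_left (u v w : Fin 2 → ℝ) : symp (u + v) w = symp u w + symp v w := by
  simp [symp]; ring
lemma symp_add_right (u v w : Fin 2 → ℝ) : symp u (v + w) = symp u v + symp u w := by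
  simp [symp]; ring
lemma symp_smul_left (s : ℝ) (v w : Fin 2 → ℝ) : symp (s • v) w = s * symp v w := by
  simp [symp]; ring
lemma symp_smul_right (s : ℝ) (v w : Fin 2 → ℝ) : symp v (s • w) = s * symp v w := by
  simp [symp]; ring

lemma PSL_eq_iff (g h : SL(2, ℝ)) : (g : PSL(2, ℝ)) = h ↔ h = g ∨ h = -g := by
  rw [QuotientGroup.eq, Matrix.SpecialLinearGroup.mem_center_iff]
  constructor
  · rintro ⟨r, hr, h1⟩
    have h2 : (h : Matrix (Fin 2) (Fin 2) ℝ) = r • (g : Matrix (Fin 2) (Fin 2) ℝ) := by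
      have h3 : (h : Matrix (Fin 2) (Fin 2) ℝ) = g * (g⁻¹ * h : SL(2, ℝ)) := by
        rw [← Matrix.SpecialLinearGroup.coe_mul, mul_inv_cancel_left]
      rw [h3, ← h1]
      ext i j
      simp [mul_comm]
    rw [Fintype.card_fin] at hr
    rcases (sq_eq_sq_iff_eq_or_eq_neg.1 (hr.trans (one_pow 2).symm)) with rfl | rfl
    · left; ext i j; simp [h2]
    · right; ext i j; simp [h2]
  · rintro (rfl | rfl)
    · exact ⟨1, by simp, by simp⟩
    · refine ⟨-1, by simp, ?_⟩
      ext i j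
      fin_cases i <;> fin_cases j <;> simp

/-- The class of `transv 1 v` in `PSL(2, ℝ)`. -/
def ptransv (v : Fin 2 → ℝ) : PSL(2, ℝ) := (transv 1 v : SL(2, ℝ))

lemma SL2_continuous_apply (i j : Fin 2) : Continuous fun g : SL(2, ℝ) => g i j :=
  (continuous_apply_apply i j).comp continuous_subtype_val

lemma act_neg (g : SL(2, ℝ)) (w : Fin 2 → ℝ) : act (-g) w = -act g w := by
  ext i; fin_cases i <;> simp <;> ring

lemma arcSum_neg (e v : Fin 2 → ℝ) (b : Fin 3 → Fin 2 → ℝ) (g : SL(2, ℝ)) :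
    arcSum e v b (-g) = arcSum e v b g := by
  refine Finset.sum_congr rfl fun k _ => ?_
  rw [act_neg]
  simp only [arcForm, symp, Pi.neg_apply]
  ring

lemma continuous_arcSum (e v : Fin 2 → ℝ) (b : Fin 3 → Fin 2 → ℝ) :
    Continuous (arcSum e v b) := by
  have h := SL2_continuous_apply
  have h00 := h 0 0
  have h01 := h 0 1
  have h10 := h 1 0
  have h11 := h 1 1
  refine continuous_finsetSum _ fun k _ => ?_
  simp only [arcForm, symp, act_zero, act_one]
  fun_prop

/-- The set where all arc sums are positive is an open neighbourhood of `1`, and ping-pong shows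
that it contains no other element of the group. Arc sums ignore the sign of the matrix, so the
argument descends to `PSL(2, ℝ)`. -/
lemma discreteTopology_of_arcs (v e b : Fin 3 → Fin 2 → ℝ)
    (h1 : ∀ i, 0 < arcSum (e i) (v i) b 1)
    (hne : ∀ i j, i ≠ j → ∀ g, arcSum (e i) (v i) b g < 0 → 0 < arcSum (e j) (v j) b g) :
    DiscreteTopology (Subgroup.closure (Set.range fun i => ptransv (v i))) := by
  set U : Set SL(2, ℝ) := {g | ∀ i, 0 < arcSum (e i) (v i) b g} with hU
  have hUo : IsOpen U := by
    rw [hU, Set.ofPred_forall]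
    exact isOpen_iInter_of_finite fun i => isOpen_lt continuous_const (continuous_arcSum _ _ _)
  have hV : IsOpen ((fun g : SL(2, ℝ) => (g : PSL(2, ℝ))) '' U) :=
    QuotientGroup.isOpenMap_coe _ hUo
  apply discreteTopology_of_isOpen_singleton_one
  convert hV.preimage continuous_subtype_val using 1
  ext ⟨x, hx⟩
  simp only [Set.mem_singleton_iff, Set.mem_preimage, Set.mem_image, Subgroup.mk_eq_one]
  constructor
  · rintro rfl
    exact ⟨1, h1, rfl⟩
  · rintro ⟨h, hhU, hhx⟩
    have hcl : Subgroup.closure (Set.range fun i => ptransv (v i)) =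
        (Subgroup.closure (Set.range fun i => transv 1 (v i))).map (QuotientGroup.mk' _) := by
      rw [MonoidHom.map_closure, ← Set.range_comp]
      rfl
    rw [hcl] at hx
    obtain ⟨g, hg, hgx⟩ := hx
    have hgU : ∀ i, 0 < arcSum (e i) (v i) b g := by
      rcases (PSL_eq_iff h g).1 (hhx.trans hgx.symm) with rfl | rfl
      · exact hhU
      · intro i; rw [arcSum_neg]; exact hhU i
    rcases closure_pingPong v _ h1 (fun i n g => arcSum_transv (e i) (v i) b n g) hne g hg with
      rfl | ⟨i, hi⟩
    · rw [← hgx]; rfl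
    · exact absurd (hgU i) hi.not_gt

/-! ### Sum-of-squares certificates that the negative half-planes are disjoint. -/

section arcs

variable {a b c m₁ m₂ m₃ : ℝ}

/-- Here `m₁`, `m₂`, `m₃` stand for `ω(u, x)`, `ω(v, x)`, `ω(w, x)`. The two arcs share an end
point, so a suitable positive combination of their forms degenerates to a multiple of one square.
The same happens in `arc_pair_second`; the arcs of `arc_pair_third` need not touch, and two squares
are required. -/
lemma arc_pair_first : c ^ 2 * -((c * m₁ + b * m₂) * ((c - a * b) * m₁ + b * m₂)) +
    b ^ 2 * -((c * m₁ + b * m₂) * (c * m₁ + (b - a * c) * m₂)) =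
    (a * b * c - b ^ 2 - c ^ 2) * (c * m₁ + b * m₂) ^ 2 := by
  ring

lemma arc_pair_second (h : a * m₃ + b * m₁ - c * m₂ = 0) :
    a ^ 2 * c ^ 2 * -((c * m₁ + (b - a * c) * m₂) * (c * m₁ + (b - a * c) * m₂ +
      (a * b * c - b ^ 2 - c ^ 2) * m₃)) + (a * b * c - b ^ 2 - c ^ 2) ^ 2 *
      -((c * m₁ + b * m₂) * (c * m₁ + (b - a * c) * m₂)) =
    ((a * b * c - b ^ 2 - c ^ 2) * (b ^ 2 + c ^ 2) - a ^ 2 * c ^ 2) *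
      (c * m₁ + (b - a * c) * m₂) ^ 2 := by
  linear_combination (-a * c ^ 2 * (c * m₁ + (b - a * c) * m₂) *
    (a * b * c - b ^ 2 - c ^ 2)) * h

lemma arc_pair_third (h : a * m₃ + b * m₁ - c * m₂ = 0) :
    a ^ 2 * b ^ 2 * -((c * m₁ + (b - a * c) * m₂) * (c * m₁ + (b - a * c) * m₂ +
      (a * b * c - b ^ 2 - c ^ 2) * m₃)) + (a * b * c - b ^ 2 - c ^ 2) ^ 2 *
      -((c * m₁ + b * m₂) * ((c - a * b) * m₁ + b * m₂)) =
    (a * b * c - a ^ 2 - b ^ 2 - c ^ 2) * b ^ 2 * (c * m₁ + (b - a * c) * m₂) ^ 2 +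
      c ^ 2 * (a * b * c - b ^ 2 - c ^ 2) * ((c - a * b) * m₁ + b * m₂) ^ 2 := by
  linear_combination (-a * b ^ 2 * (c * m₁ + (b - a * c) * m₂) *
    (a * b * c - b ^ 2 - c ^ 2)) * h

end arcs

lemma arcSum_pos_of_neg {e v e' v' : Fin 2 → ℝ} {b : Fin 3 → Fin 2 → ℝ} {s t : ℝ} (hs : 0 < s)
    (ht : 0 < t) (h : ∀ x, 0 ≤ s * arcForm e v x + t * arcForm e' v' x) (g : SL(2, ℝ)) :
    (arcSum e v b g < 0 → 0 < arcSum e' v' b g) ∧ (arcSum e' v' b g < 0 → 0 < arcSum e v b g) := by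
  have : 0 ≤ s * arcSum e v b g + t * arcSum e' v' b g := by
    rw [arcSum, arcSum, Finset.mul_sum, Finset.mul_sum, ← Finset.sum_add_distrib]
    exact Finset.sum_nonneg fun k _ => h _
  constructor <;> intro hneg
  · have := mul_neg_of_pos_of_neg hs hneg
    exact pos_of_mul_pos_right (by linarith : 0 < t * arcSum e' v' b g) ht.le
  · have := mul_neg_of_pos_of_neg ht hneg
    exact pos_of_mul_pos_right (by linarith : 0 < s * arcSum e v b g) hs.le

/-- Three arcs are chained: `f = T_u e`, `g = T_v f`, `h = T_w g`. The hypothesis `hk` says that `h`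
does not run past `e`; in the case of equality `h = e` and the arcs bound an ideal triangle. -/
lemma discreteTopology_of_pos (u v w : Fin 2 → ℝ) (ha : 0 < symp u v) (hb : 0 < symp v w)
    (hc : 0 < symp u w)
    (hk : symp u v ^ 2 + symp v w ^ 2 + symp u w ^ 2 ≤ symp u v * symp v w * symp u w) :
    DiscreteTopology (Subgroup.closure (Set.range fun i => ptransv (![u, v, w] i))) := by
  have hrel : ∀ x, symp u v * symp w x + symp v w * symp u x - symp u w * symp v x = 0 := by
    intro x; simp only [symp]; ring
  obtain ⟨a, hae⟩ : ∃ a, symp u v = a := ⟨_, rfl⟩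
  obtain ⟨b, hbe⟩ : ∃ b, symp v w = b := ⟨_, rfl⟩
  obtain ⟨c, hce⟩ : ∃ c, symp u w = c := ⟨_, rfl⟩
  have hae' : symp v u = -a := by rw [symp_swap, hae]
  have hbe' : symp w v = -b := by rw [symp_swap, hbe]
  have hce' : symp w u = -c := by rw [symp_swap, hce]
  rw [hae, hbe, hce] at hk hrel
  rw [hae] at ha
  rw [hbe] at hb
  rw [hce] at hc
  set δ := a * b * c - b ^ 2 - c ^ 2 with hδ
  have hδa : a ^ 2 ≤ δ := by linarith
  have hδ0 : 0 < δ := lt_of_lt_of_le (by positivity) hδa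
  have hW : 0 < δ * (b ^ 2 + c ^ 2) - a ^ 2 * c ^ 2 := by
    have : a ^ 2 * (b ^ 2 + c ^ 2) ≤ δ * (b ^ 2 + c ^ 2) := by gcongr
    have : 0 < a ^ 2 * b ^ 2 := by positivity
    linarith
  -- In the case of equality in `hk`, this `e` is fixed by `T_w T_v T_u`.
  set e : Fin 2 → ℝ := (c - a * b) • u + b • v with he
  set f : Fin 2 → ℝ := c • u + b • v with hf
  set g : Fin 2 → ℝ := c • u + (b - a * c) • v with hg
  set h : Fin 2 → ℝ := g + δ • w with hh
  have Q1 : ∀ x, arcForm e u x = -((c * symp u x + b * symp v x) *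
      ((c - a * b) * symp u x + b * symp v x)) := by
    intro x
    simp only [arcForm, he, symp_add_left, symp_smul_left, symp_self, hae']
    ring
  have Q2 : ∀ x, arcForm f v x = -((c * symp u x + b * symp v x) *
      (c * symp u x + (b - a * c) * symp v x)) := by
    intro x
    simp only [arcForm, hf, symp_add_left, symp_smul_left, symp_self, hae]
    ring
  have Q3 : ∀ x, arcForm g w x = -((c * symp u x + (b - a * c) * symp v x) *
      (c * symp u x + (b - a * c) * symp v x + δ * symp w x)) := by
    intro x
    simp only [arcForm, hg, symp_add_left, symp_smul_left, hbe, hce]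
    ring
  have P12 : ∀ x, 0 ≤ c ^ 2 * arcForm e u x + b ^ 2 * arcForm f v x := by
    intro x
    rw [Q1, Q2, arc_pair_first]
    positivity
  have P32 : ∀ x, 0 ≤ a ^ 2 * c ^ 2 * arcForm g w x + δ ^ 2 * arcForm f v x := by
    intro x
    rw [Q3, Q2, arc_pair_second (hrel x)]
    positivity
  have P31 : ∀ x, 0 ≤ a ^ 2 * b ^ 2 * arcForm g w x + δ ^ 2 * arcForm e u x := by
    intro x
    rw [Q3, Q1, arc_pair_third (hrel x)]
    have : 0 ≤ a * b * c - a ^ 2 - b ^ 2 - c ^ 2 := by linarith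
    positivity
  have I1 := arcSum_pos_of_neg (b := ![f, g, h]) (by positivity) (by positivity) P12
  have I2 := arcSum_pos_of_neg (b := ![f, g, h]) (by positivity) (by positivity) P32
  have I3 := arcSum_pos_of_neg (b := ![f, g, h]) (by positivity) (by positivity) P31
  have uf : symp u f = a * b := by
    simp only [hf, symp_add_right, symp_smul_right, symp_self, hae]; ring
  have vf : symp v f = -(a * c) := by
    simp only [hf, symp_add_right, symp_smul_right, symp_self, hae']; ring
  have wf : symp w f = -(b ^ 2 + c ^ 2) := by
    simp only [hf, symp_add_right, symp_smul_right, hbe', hce']; ring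
  have ug : symp u g = (b - a * c) * a := by
    simp only [hg, symp_add_right, symp_smul_right, symp_self, hae]; ring
  have vg : symp v g = -(a * c) := by
    simp only [hg, symp_add_right, symp_smul_right, symp_self, hae']; ring
  have wg : symp w g = δ := by
    simp only [hg, symp_add_right, symp_smul_right, hbe', hce']; ring
  have uh : symp u h = (b - a * c) * a + δ * c := by
    simp only [hh, symp_add_right, symp_smul_right, ug, hce]
  have vh : symp v h = -(a * c) + δ * b := by
    simp only [hh, symp_add_right, symp_smul_right, vg, hbe]
  have wh : symp w h = δ := by
    simp only [hh, symp_add_right, symp_smul_right, wg, symp_self]; ring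
  have hsum : ∀ e' v' : Fin 2 → ℝ, arcSum e' v' ![f, g, h] 1 =
      arcForm e' v' f + arcForm e' v' g + arcForm e' v' h := by
    intro e' v'
    simp [arcSum, Fin.sum_univ_three, act_id]
  -- The base vectors are `f`, `g`, `h`. Each form vanishes at its own end points, so few terms of
  -- the sums survive and their signs are explicit.
  refine discreteTopology_of_arcs ![u, v, w] ![e, f, g] ![f, g, h] ?_ ?_
  · intro i
    fin_cases i
    · have : arcSum e u ![f, g, h] 1 = a ^ 4 * c ^ 2 * δ +
          δ * (δ - a ^ 2) * (δ * (b ^ 2 + c ^ 2) - a ^ 2 * c ^ 2) := by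
        rw [hsum, Q1, Q1, Q1, uf, vf, ug, vg, uh, vh, hδ]
        ring
      simp only [Fin.zero_eta, Matrix.cons_val_zero]
      rw [this]
      have : 0 ≤ δ - a ^ 2 := by linarith
      positivity
    · have : arcSum f v ![f, g, h] 1 = δ ^ 2 * (δ * (b ^ 2 + c ^ 2) - a ^ 2 * c ^ 2) := by
        rw [hsum, Q2, Q2, Q2, uf, vf, ug, vg, uh, vh, hδ]
        ring
      simp only [Fin.mk_one, Matrix.cons_val_one, Matrix.cons_val_zero]
      rw [this]
      positivity
    · have : arcSum g w ![f, g, h] 1 = a ^ 2 * c ^ 2 *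
          (δ * (b ^ 2 + c ^ 2) - a ^ 2 * c ^ 2) := by
        rw [hsum, Q3, Q3, Q3, uf, vf, wf, ug, vg, wg, uh, vh, wh, hδ]
        ring
      simp only [Fin.reduceFinMk, Matrix.cons_val]
      rw [this]
      positivity
  · intro i j hij γ
    fin_cases i <;> fin_cases j <;> first | exact absurd rfl hij | skip
    · exact (I1 γ).1
    · exact (I3 γ).2
    · exact (I1 γ).2
    · exact (I2 γ).2
    · exact (I3 γ).1
    · exact (I2 γ).1

/-! ### Elliptic elements of torsion-free groups -/

lemma symp_act (g : SL(2, ℝ)) (v w : Fin 2 → ℝ) : symp (act g v) (act g w) = symp v w := by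
  have := SL2_det g
  simp only [symp, act_zero, act_one]
  linear_combination (v 0 * w 1 - v 1 * w 0) * this

/-- The quadratic form `w ↦ ω(w, m w)` is invariant under `m`, and it is definite because its
discriminant is `tr² - 4 < 0`. It therefore bounds all orbits. -/
lemma elliptic_pow_bounded (m : SL(2, ℝ)) (hm : (m 0 0 + m 1 1) ^ 2 < 4) :
    ∃ R : ℝ, ∀ (n : ℕ) i j, |(m ^ n) i j| ≤ R := by
  have hinv : ∀ (n : ℕ) w, symp (act (m ^ n) w) (act m (act (m ^ n) w)) = symp w (act m w) := by
    intro n w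
    rw [← act_mul, ← pow_succ', pow_succ, act_mul, symp_act]
  set D := 4 - (m 0 0 + m 1 1) ^ 2 with hD
  have hD0 : 0 < D := by linarith
  have hdet := SL2_det m
  have h1 : ∀ (n : ℕ) w, act (m ^ n) w 1 ^ 2 * D ≤ 4 * m 1 0 * symp w (act m w) := by
    intro n w
    rw [← hinv n w]
    generalize act (m ^ n) w = x
    have : 4 * m 1 0 * symp x (act m x) =
        (2 * m 1 0 * x 0 + (m 1 1 - m 0 0) * x 1) ^ 2 + x 1 ^ 2 * D := by
      simp only [symp, act_zero, act_one, hD]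
      linear_combination 4 * x 1 ^ 2 * hdet
    rw [this]
    exact le_add_of_nonneg_left (sq_nonneg _)
  have h0 : ∀ (n : ℕ) w, act (m ^ n) w 0 ^ 2 * D ≤ -4 * m 0 1 * symp w (act m w) := by
    intro n w
    rw [← hinv n w]
    generalize act (m ^ n) w = x
    have : -4 * m 0 1 * symp x (act m x) =
        (2 * m 0 1 * x 1 - (m 1 1 - m 0 0) * x 0) ^ 2 + x 0 ^ 2 * D := by
      simp only [symp, act_zero, act_one, hD]
      linear_combination 4 * x 0 ^ 2 * hdet
    rw [this]
    exact le_add_of_nonneg_left (sq_nonneg _)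
  have key : ∀ (c q : ℝ), ∃ R, ∀ x : ℝ, x ^ 2 * D ≤ c * q → |x| ≤ R := fun c q =>
    ⟨√(c * q / D), fun x hx => Real.abs_le_sqrt ((le_div_iff₀ hD0).2 hx)⟩
  have hcol : ∀ i j, ∃ R, ∀ n : ℕ, |(m ^ n) i j| ≤ R := by
    intro i j
    obtain ⟨R, hR⟩ := key (if i = 0 then -4 * m 0 1 else 4 * m 1 0)
      (symp (Pi.single j 1) (act m (Pi.single j 1)))
    refine ⟨R, fun n => hR _ ?_⟩
    have e1 := h0 n (Pi.single j 1)
    have e2 := h1 n (Pi.single j 1)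
    fin_cases i <;> fin_cases j <;> simp_all
  choose R hR using hcol
  refine ⟨∑ i, ∑ j, |R i j|, fun n i j => (hR i j n).trans ((le_abs_self _).trans ?_)⟩
  exact (Finset.single_le_sum (f := fun j => |R i j|) (fun _ _ => abs_nonneg _)
    (Finset.mem_univ j)).trans (Finset.single_le_sum (f := fun i => ∑ j, |R i j|)
      (fun _ _ => Finset.sum_nonneg fun _ _ => abs_nonneg _) (Finset.mem_univ i))

/-- The powers stay in a compact set; quotients of consecutive terms of a convergent subsequence
tend to `1`. -/
lemma exists_pow_mem_of_elliptic (m : SL(2, ℝ)) (hm : (m 0 0 + m 1 1) ^ 2 < 4)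
    (U : Set SL(2, ℝ)) (hU : U ∈ nhds 1) : ∃ n : ℕ, n ≠ 0 ∧ m ^ n ∈ U := by
  obtain ⟨R, hR⟩ := elliptic_pow_bounded m hm
  have hK : IsCompact (Set.univ.pi fun _ : Fin 2 => Set.univ.pi fun _ : Fin 2 =>
      Set.Icc (-R) R) := isCompact_univ_pi fun _ => isCompact_univ_pi fun _ => isCompact_Icc
  obtain ⟨L, _, φ, hφ, hlim⟩ := hK.tendsto_subseq
    (x := fun (n : ℕ) (i j : Fin 2) => (m ^ n) i j) (fun n i _ j _ => abs_le.1 (hR n i j))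
  change Filter.Tendsto (fun k => ((m ^ φ k : SL(2, ℝ)) : Matrix (Fin 2) (Fin 2) ℝ))
    Filter.atTop (@nhds (Matrix (Fin 2) (Fin 2) ℝ) _ L) at hlim
  have hdet : Matrix.det L = 1 := by
    have h1 : Filter.Tendsto (fun k => Matrix.det
        ((m ^ φ k : SL(2, ℝ)) : Matrix (Fin 2) (Fin 2) ℝ)) Filter.atTop (nhds (Matrix.det L)) :=
      ((Continuous.matrix_det continuous_id).tendsto L).comp hlim
    simp only [Matrix.SpecialLinearGroup.det_coe] at h1
    exact tendsto_nhds_unique h1 tendsto_const_nhds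
  obtain ⟨L', hlim'⟩ : ∃ L' : SL(2, ℝ), Filter.Tendsto (fun k => m ^ φ k) Filter.atTop
      (nhds L') := ⟨⟨L, hdet⟩, tendsto_subtype_rng.2 hlim⟩
  have h2 := (hlim'.comp (Filter.tendsto_add_atTop_nat 1)).mul hlim'.inv
  rw [mul_inv_cancel] at h2
  obtain ⟨k, hk⟩ := (h2.eventually hU).exists
  have hlt : φ k < φ (k + 1) := hφ k.lt_succ_self
  refine ⟨φ (k + 1) - φ k, (Nat.sub_pos_of_lt hlt).ne', ?_⟩
  rw [pow_sub _ hlt.le]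
  exact hk

lemma not_discreteTopology_of_elliptic {Γ : Subgroup PSL(2, ℝ)}
    (hΓ : ∀ g ∈ Γ, ∀ n : ℕ, n ≠ 0 → g ^ n = 1 → g = 1) (m : SL(2, ℝ))
    (hmΓ : (m : PSL(2, ℝ)) ∈ Γ) (hm : (m 0 0 + m 1 1) ^ 2 < 4) : ¬ DiscreteTopology Γ := by
  intro hd
  obtain ⟨V, hV, hVΓ⟩ := isOpen_induced_iff.1 (isOpen_discrete ({1} : Set Γ))
  have h1V : (1 : PSL(2, ℝ)) ∈ V := by
    have : (1 : Γ) ∈ Subtype.val ⁻¹' V := by rw [hVΓ]; rfl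
    exact this
  obtain ⟨n, hn, hnU⟩ := exists_pow_mem_of_elliptic m hm
    ((fun g : SL(2, ℝ) => (g : PSL(2, ℝ))) ⁻¹' V)
    ((hV.preimage QuotientGroup.continuous_mk).mem_nhds h1V)
  have h3 : (⟨(m : PSL(2, ℝ)) ^ n, Γ.pow_mem hmΓ n⟩ : Γ) ∈ Subtype.val ⁻¹' V := hnU
  rw [hVΓ] at h3
  have h4 := hΓ _ hmΓ n hn (congrArg Subtype.val h3)
  rcases (PSL_eq_iff 1 m).1 h4.symm with rfl | rfl <;> norm_num at hm

/-! ### Free groups of rank three -/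

/-- A counting argument: restricting homomorphisms to the generators `g` gives an injective self-map
of the finite set `Fin 3 → H`, which is then surjective. -/
lemma exists_hom_of_free {G : Type*} [Group G] (e : Nonempty (G ≃* FreeGroup (Fin 3)))
    (g : Fin 3 → G) (hg : Subgroup.closure (Set.range g) = ⊤) {H : Type*} [Group H] [Finite H]
    (h : Fin 3 → H) : ∃ φ : G →* H, ∀ i, φ (g i) = h i := by
  obtain ⟨e⟩ := e
  have hinj : Function.Injective fun (f : Fin 3 → H) i => FreeGroup.lift f (e (g i)) := by
    intro f f' hff
    have : (FreeGroup.lift f).comp e.toMonoidHom = (FreeGroup.lift f').comp e.toMonoidHom := by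
      apply MonoidHom.eq_of_eqOn_dense hg
      rintro _ ⟨i, rfl⟩
      exact congrFun hff i
    apply FreeGroup.lift.injective
    ext i
    simpa using DFunLike.congr_fun this (e.symm (FreeGroup.of i))
  obtain ⟨f, hf⟩ := Finite.surjective_of_injective hinj h
  exact ⟨(FreeGroup.lift f).comp e.toMonoidHom, fun i => congrFun hf i⟩

lemma torsionFree_of_free {G : Type*} [Group G] (e : Nonempty (G ≃* FreeGroup (Fin 3)))
    (g : G) (n : ℕ) (hn : n ≠ 0) (h : g ^ n = 1) : g = 1 := by
  obtain ⟨e⟩ := e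
  have : e g ^ n = 1 := by rw [← map_pow, h, map_one]
  rwa [pow_eq_one_iff_left hn, map_eq_one_iff e e.injective] at this

/-! ### Groups generated by three transvections -/

/-- A relation between the given generators would hold for every triple in every finite group. Thus
non-relations can be tested in a symmetric group. -/
lemma free_not_relation {G : Type*} [Group G] {Γ : Subgroup G} {p q r : G}
    (hΓ : Γ = Subgroup.closure {p, q, r}) (e : Nonempty (Γ ≃* FreeGroup (Fin 3)))
    {H : Type*} [Group H] [Finite H] (h : Fin 3 → H) (W : FreeGroup (Fin 3))
    (hW : FreeGroup.lift ![p, q, r] W = 1) : FreeGroup.lift h W = 1 := by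
  have hmem : ∀ i, ![p, q, r] i ∈ Γ := by
    intro i
    rw [hΓ]
    apply Subgroup.subset_closure
    fin_cases i <;> simp
  set g : Fin 3 → Γ := fun i => ⟨![p, q, r] i, hmem i⟩ with hg
  have hcl : Subgroup.closure (Set.range g) = ⊤ := by
    apply Subgroup.map_injective Γ.subtype_injective
    rw [MonoidHom.map_closure, ← Set.range_comp, ← MonoidHom.range_eq_map, Subgroup.range_subtype]
    conv_rhs => rw [hΓ]
    congr 1
    ext x
    simp [hg, Fin.exists_fin_succ, eq_comm]
  obtain ⟨φ, hφ⟩ := exists_hom_of_free e g hcl h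
  have h1 : φ.comp (FreeGroup.lift g) = FreeGroup.lift h := by
    ext i
    simp [hφ]
  have h2 : Γ.subtype.comp (FreeGroup.lift g) = FreeGroup.lift ![p, q, r] := by
    ext i
    simp [hg]
  have h3 : FreeGroup.lift g W = 1 := by
    apply Γ.subtype_injective
    rw [← MonoidHom.comp_apply, h2, hW, map_one]
  rw [← h1, MonoidHom.comp_apply, h3, map_one]

section free

variable {G : Type*} [Group G] {Γ : Subgroup G} {p q r : G}

lemma free_not_commute (hΓ : Γ = Subgroup.closure {p, q, r})
    (e : Nonempty (Γ ≃* FreeGroup (Fin 3))) : p * q ≠ q * p := by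
  intro h
  have := free_not_relation hΓ e
    ![(Equiv.swap 0 1 : Equiv.Perm (Fin 3)), Equiv.swap 1 2, 1]
    (.of 0 * .of 1 * (.of 0)⁻¹ * (.of 1)⁻¹) (by simp [h])
  simp only [map_mul, map_inv, FreeGroup.lift_apply_of] at this
  revert this
  decide

lemma free_not_commute_conj (hΓ : Γ = Subgroup.closure {p, q, r})
    (e : Nonempty (Γ ≃* FreeGroup (Fin 3))) :
    r * (p * q * r * (p * q)⁻¹) ≠ p * q * r * (p * q)⁻¹ * r := by
  intro h
  -- With `p ↦ 1`, the conjugate of `(0 1)` by `(1 2)` is `(0 2)`, which does not commute with `(0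
  -- 1)`.
  have := free_not_relation hΓ e
    ![1, (Equiv.swap 1 2 : Equiv.Perm (Fin 3)), Equiv.swap 0 1]
    (.of 2 * (.of 0 * .of 1 * .of 2 * (.of 0 * .of 1)⁻¹) *
      (.of 0 * .of 1 * .of 2 * (.of 0 * .of 1)⁻¹ * .of 2)⁻¹) (by
    simp only [map_mul, map_inv, FreeGroup.lift_apply_of]
    rw [mul_inv_eq_one]
    exact h)
  simp only [map_mul, map_inv, FreeGroup.lift_apply_of] at this
  revert this
  decide

lemma closure_conj_third {g : G} (hg : g ∈ Subgroup.closure {p}) :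
    Subgroup.closure {p, q, g * r * g⁻¹} = Subgroup.closure {p, q, r} := by
  have h1 : ∀ s, g ∈ Subgroup.closure ({p, q, s} : Set G) := fun s =>
    Subgroup.closure_mono (by simp) hg
  apply le_antisymm <;> rw [Subgroup.closure_le] <;> rintro x (rfl | rfl | rfl)
  · exact Subgroup.subset_closure (by simp)
  · exact Subgroup.subset_closure (by simp)
  · exact mul_mem (mul_mem (h1 r) (Subgroup.subset_closure (by simp))) (inv_mem (h1 r))
  · exact Subgroup.subset_closure (by simp)
  · exact Subgroup.subset_closure (by simp)
  · have h2 := mul_mem (mul_mem (inv_mem (h1 (g * x * g⁻¹)))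
      (Subgroup.subset_closure (by simp : g * x * g⁻¹ ∈ ({p, q, g * x * g⁻¹} : Set G))))
      (h1 (g * x * g⁻¹))
    simpa [mul_assoc] using h2

end free

/-- `Γ` is generated by the transvections along three vectors whose symplectic products `a`, `b`,
`c` satisfy `x = a ^ 2`, `y = b ^ 2`, `z = c ^ 2` and `t = |a b c|`. -/
def HasTriple (Γ : Subgroup PSL(2, ℝ)) (x y z t : ℝ) : Prop :=
  ∃ u v w, Γ = Subgroup.closure {ptransv u, ptransv v, ptransv w} ∧ x = symp u v ^ 2 ∧
    y = symp v w ^ 2 ∧ z = symp u w ^ 2 ∧ t = |symp u v * symp v w * symp u w|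

section triple

variable {Γ : Subgroup PSL(2, ℝ)} {x y z t : ℝ}

lemma HasTriple.swap (h : HasTriple Γ x y z t) : HasTriple Γ x z y t := by
  obtain ⟨u, v, w, hΓ, rfl, rfl, rfl, rfl⟩ := h
  refine ⟨v, u, w, ?_, ?_, rfl, rfl, ?_⟩
  · rw [hΓ, Set.insert_comm]
  · rw [symp_swap u v, neg_sq]
  · rw [symp_swap u v, neg_mul, neg_mul, abs_neg]
    congr 1; ring

lemma HasTriple.rotate (h : HasTriple Γ x y z t) : HasTriple Γ y z x t := by
  obtain ⟨u, v, w, hΓ, rfl, rfl, rfl, rfl⟩ := h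
  refine ⟨v, w, u, ?_, rfl, ?_, ?_, ?_⟩
  · rw [hΓ, Set.insert_comm, Set.pair_comm (ptransv u)]
  · rw [symp_swap u w, neg_sq]
  · rw [symp_swap u v, neg_sq]
  · rw [symp_swap u v, symp_swap u w]
    congr 1; ring

lemma ptransv_conj (g : SL(2, ℝ)) (v : Fin 2 → ℝ) :
    (g : PSL(2, ℝ)) * ptransv v * (g : PSL(2, ℝ))⁻¹ = ptransv (act g v) := by
  rw [ptransv, ptransv, ← transv_conj]
  rfl

/-- Replace `w` by `T_u^s w`, where `s` is the sign of `abc`. Then `b` becomes `b - s a c`, which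
has absolute value `||b| - |a||c||`. -/
lemma HasTriple.reduce (h : HasTriple Γ x y z t) :
    HasTriple Γ x (x * z - 2 * t + y) z |x * z - t| := by
  obtain ⟨u, v, w, hΓ, rfl, rfl, rfl, rfl⟩ := h
  obtain ⟨s, hs, hst⟩ : ∃ s : ℝ, (s = 1 ∨ s = -1) ∧ |symp u v * symp v w * symp u w| =
      s * (symp u v * symp v w * symp u w) := by
    rcases abs_choice (symp u v * symp v w * symp u w) with h | h
    · exact ⟨1, .inl rfl, by rw [h, one_mul]⟩
    · exact ⟨-1, .inr rfl, by rw [h, neg_one_mul]⟩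
  have hs2 : s ^ 2 = 1 := by rcases hs with rfl | rfl <;> norm_num
  have hmem : ((transv s u : SL(2, ℝ)) : PSL(2, ℝ)) ∈ Subgroup.closure {ptransv u} := by
    rcases hs with rfl | rfl
    · exact Subgroup.subset_closure rfl
    · have : ((transv (-1) u : SL(2, ℝ)) : PSL(2, ℝ)) = (ptransv u)⁻¹ := by
        rw [← transv_inv]; rfl
      rw [this]
      exact inv_mem (Subgroup.subset_closure rfl)
  have huw : symp u (act (transv s u) w) = symp u w := by
    rw [act_transv, symp_add_right, symp_smul_right, symp_self, mul_zero, add_zero]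
  have hvw : symp v (act (transv s u) w) = symp v w - s * symp u w * symp u v := by
    rw [act_transv, symp_add_right, symp_smul_right, symp_swap u v]
    ring
  refine ⟨u, v, act (transv s u) w, ?_, rfl, ?_, ?_, ?_⟩
  · rw [← ptransv_conj, closure_conj_third hmem, hΓ]
  · rw [hvw, hst]
    linear_combination (-(symp u v ^ 2 * symp u w ^ 2)) * hs2
  · rw [huw]
  · rw [hst, huw, hvw]
    have h1 : |s| = 1 := by rcases hs with rfl | rfl <;> simp
    rw [← one_mul (|symp u v * (_ - _) * _|), ← h1, ← abs_mul, ← abs_neg]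
    congr 1
    linear_combination (symp u v ^ 2 * symp u w ^ 2) * hs2

/-! ### Short elliptic words as witnesses of non-discreteness. -/

lemma not_discreteTopology_of_symp (e : Nonempty (Γ ≃* FreeGroup (Fin 3))) {u v : Fin 2 → ℝ}
    (hu : ptransv u ∈ Γ) (hv : ptransv v ∈ Γ) (hne : ptransv u * ptransv v ≠ ptransv v * ptransv u)
    (h : symp u v ^ 2 < 4) : ¬ DiscreteTopology Γ := by
  -- If `ω(u, v) = 0`, then `T_u` fixes `v` and commutes with `T_v`.
  have h0 : 0 < symp u v ^ 2 := by
    rw [sq_pos_iff]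
    intro h0
    apply hne
    have := ptransv_conj (transv 1 u) v
    rw [act_transv, h0, mul_zero, zero_smul, add_zero, mul_inv_eq_iff_eq_mul] at this
    exact this
  have htr : (transv 1 u * transv 1 v : SL(2, ℝ)) 0 0 + (transv 1 u * transv 1 v : SL(2, ℝ)) 1 1 =
      2 - symp u v ^ 2 := by
    simp only [SL2_mul_apply, transv_00, transv_01, transv_10, transv_11, symp]
    ring
  refine not_discreteTopology_of_elliptic (fun g hg n hn h => ?_) (transv 1 u * transv 1 v)
    (mul_mem hu hv) (by rw [htr]; nlinarith)
  exact congrArg Subtype.val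
    (torsionFree_of_free e ⟨g, hg⟩ n hn (Subtype.ext h))

lemma not_discreteTopology_of_lt_four (e : Nonempty (Γ ≃* FreeGroup (Fin 3)))
    (h : HasTriple Γ x y z t) (hx : x < 4) : ¬ DiscreteTopology Γ := by
  obtain ⟨u, v, w, hΓ, rfl, rfl, rfl, rfl⟩ := h
  refine not_discreteTopology_of_symp e ?_ ?_ (free_not_commute hΓ e) hx <;>
    exact hΓ ▸ Subgroup.subset_closure (by simp)

/-- Exchanging `u` and `v` changes the sign of `abc`, so the order of the generators can be chosen
to make it nonpositive. This exchanges `y` and `z`, hence only their sum is recorded. -/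
lemma HasTriple.oriented (h : HasTriple Γ x y z t) :
    ∃ u v w, Γ = Subgroup.closure {ptransv u, ptransv v, ptransv w} ∧ x = symp u v ^ 2 ∧
      y + z = symp v w ^ 2 + symp u w ^ 2 ∧ t = -(symp u v * symp v w * symp u w) := by
  obtain ⟨u, v, w, hΓ, rfl, rfl, rfl, rfl⟩ := h
  rcases abs_choice (symp u v * symp v w * symp u w) with h | h
  · refine ⟨v, u, w, by rw [hΓ, Set.insert_comm], ?_, add_comm _ _, ?_⟩
    · rw [symp_swap u v, neg_sq]
    · rw [h, symp_swap u v]; ring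
  · exact ⟨u, v, w, hΓ, rfl, rfl, h⟩

/-- For the right order of the generators, `T_u T_v T_w` has trace `2 - K`. -/
lemma not_discreteTopology_of_triple_trace (e : Nonempty (Γ ≃* FreeGroup (Fin 3)))
    (h : HasTriple Γ x y z t) (h0 : 0 < x + y + z - t) (h4 : x + y + z - t < 4) :
    ¬ DiscreteTopology Γ := by
  obtain ⟨u, v, w, hΓ, rfl, hyz, rfl⟩ := h.oriented
  have htr : (transv 1 u * transv 1 v * transv 1 w : SL(2, ℝ)) 0 0 +
      (transv 1 u * transv 1 v * transv 1 w : SL(2, ℝ)) 1 1 =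
      2 - (symp u v ^ 2 + (symp v w ^ 2 + symp u w ^ 2) +
        symp u v * symp v w * symp u w) := by
    simp only [SL2_mul_apply, transv_00, transv_01, transv_10, transv_11, symp]
    ring
  have hm : ((transv 1 u * transv 1 v * transv 1 w : SL(2, ℝ)) : PSL(2, ℝ)) ∈ Γ := by
    have h1 : ∀ s ∈ ({ptransv u, ptransv v, ptransv w} : Set PSL(2, ℝ)), s ∈ Γ := fun s hs =>
      hΓ ▸ Subgroup.subset_closure hs
    exact mul_mem (mul_mem (h1 (ptransv u) (by simp)) (h1 (ptransv v) (by simp)))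
      (h1 (ptransv w) (by simp))
  refine not_discreteTopology_of_elliptic (fun g hg n hn h => ?_) _ hm
    (by rw [htr, ← hyz]; nlinarith)
  exact congrArg Subtype.val
    (torsionFree_of_free e ⟨g, hg⟩ n hn (Subtype.ext h))

/-- The vector `w` and its image under `T_u T_v` pair to `t - y - z`. Freeness prevents the two
transvections from commuting, so this pairing is nonzero. -/
lemma not_discreteTopology_of_conj (e : Nonempty (Γ ≃* FreeGroup (Fin 3)))
    (h : HasTriple Γ x y z t) (h4 : (t - y - z) ^ 2 < 4) : ¬ DiscreteTopology Γ := by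
  obtain ⟨u, v, w, hΓ, rfl, hyz, rfl⟩ := h.oriented
  have h1 : ∀ s ∈ ({ptransv u, ptransv v, ptransv w} : Set PSL(2, ℝ)), s ∈ Γ := fun s hs =>
    hΓ ▸ Subgroup.subset_closure hs
  have hu := h1 (ptransv u) (by simp)
  have hv := h1 (ptransv v) (by simp)
  have hw := h1 (ptransv w) (by simp)
  have hconj : ptransv (act (transv 1 u * transv 1 v) w) =
      ptransv u * ptransv v * ptransv w * (ptransv u * ptransv v)⁻¹ := by
    rw [← ptransv_conj]; rfl
  refine not_discreteTopology_of_symp e (v := act (transv 1 u * transv 1 v) w) hw ?_ ?_ ?_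
  · rw [hconj]
    exact mul_mem (mul_mem (mul_mem hu hv) hw) (inv_mem (mul_mem hu hv))
  · rw [hconj]
    exact free_not_commute_conj hΓ e
  · have : symp w (act (transv 1 u * transv 1 v) w) =
        -(symp u v * symp v w * symp u w) - (symp v w ^ 2 + symp u w ^ 2) := by
      simp only [act_mul, act_transv, symp, Pi.add_apply, Pi.smul_apply, smul_eq_mul]
      ring
    rw [this, ← hyz]
    linarith

lemma HasTriple.discreteTopology (h : HasTriple Γ x y z t) (hx : 0 < x) (hy : 0 < y) (hz : 0 < z)
    (hk : x + y + z ≤ t) : DiscreteTopology Γ := by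
  obtain ⟨u, v, w, hΓ, rfl, rfl, rfl, rfl⟩ := h
  have key : ∀ v : Fin 2 → ℝ, ∃ (s : ℝ) (v' : Fin 2 → ℝ), |s| = 1 ∧ v' = s • v ∧
      ptransv v' = ptransv v ∧ symp u v' = |symp u v| := by
    intro v
    rcases abs_choice (symp u v) with h | h
    · exact ⟨1, v, abs_one, by simp, rfl, h.symm⟩
    · refine ⟨-1, -v, by simp, by simp, ?_, ?_⟩
      · rw [ptransv, transv_neg]; rfl
      · rw [h]; simp [symp]; ring
  obtain ⟨r, v', hr, hv', hpv, hav⟩ := key v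
  obtain ⟨s, w', hs, hw', hpw, haw⟩ := key w
  have hb : |symp v' w'| = |symp v w| := by
    rw [hv', hw', symp_smul_left, symp_smul_right, abs_mul, abs_mul, hr, hs, one_mul, one_mul]
  rw [← hpv, ← hpw] at hΓ
  have h1 : 0 < symp u v' := by rw [hav]; exact abs_pos.2 (sq_pos_iff.1 hx)
  have h2 : 0 < symp u w' := by rw [haw]; exact abs_pos.2 (sq_pos_iff.1 hz)
  rw [abs_mul, abs_mul, ← sq_abs (symp u v), ← sq_abs (symp v w), ← sq_abs (symp u w), ← hav,
    ← haw, ← hb, sq_abs (symp v' w')] at hk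
  have hb0 : symp v' w' ≠ 0 := by
    rw [← abs_pos, hb]; exact abs_pos.2 (sq_pos_iff.1 hy)
  have hr3 : ∀ p q r : PSL(2, ℝ), Set.range ![p, q, r] = {p, q, r} := fun p q r => by
    simp only [Matrix.range_cons, Matrix.range_empty, Set.union_empty, Set.singleton_union]
  have hcomp : ∀ p q r, (Set.range fun i => ptransv (![p, q, r] i)) =
      {ptransv p, ptransv q, ptransv r} := fun p q r => by
    rw [← hr3]
    congr 1
    ext i : 1
    fin_cases i <;> rfl
  -- Signs of `v` and `w` were chosen to make `a` and `c` positive; exchanging `v` and `w` takes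
  -- care of a negative `b`.
  rcases lt_or_gt_of_ne hb0 with h | h
  · have h3 : symp w' v' = -symp v' w' := symp_swap _ _
    rw [abs_of_neg h] at hk
    have := discreteTopology_of_pos u w' v' h2 (by linarith) h1 (by rw [h3]; linarith)
    rw [hcomp, Set.pair_comm] at this
    rwa [hΓ]
  · rw [abs_of_pos h] at hk
    have := discreteTopology_of_pos u v' w' h1 h h2 hk
    rw [hcomp] at this
    rwa [hΓ]

/-! ### Descent on triples. -/

lemma HasTriple.nonneg (h : HasTriple Γ x y z t) : 0 ≤ t := by
  obtain ⟨u, v, w, -, -, -, -, rfl⟩ := h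
  exact abs_nonneg _

lemma HasTriple.sq_eq (h : HasTriple Γ x y z t) : t ^ 2 = x * y * z := by
  obtain ⟨u, v, w, -, rfl, rfl, rfl, rfl⟩ := h
  rw [sq_abs]; ring

/-- The point is `2t - xz ≥ 8`. Its square is `xz` times `(x - 4)(z - 4) + 4(K - 4)`, where `xz ≥
16` and the second factor is at least `4`. -/
lemma reduce_le (hx : 4 ≤ x) (hz : 4 ≤ z) (hK : 4 ≤ x + y + z - t)
    (ht : t ^ 2 = x * y * z) (h1 : 4 ≤ (t - y - z) ^ 2)
    (h2 : 4 ≤ (t - x - y) ^ 2) (hlt : x * z < 2 * t) : |x * z - t| ≤ t - 8 := by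
  have hxz : 16 ≤ x * z := by nlinarith
  have hdisc : 4 ≤ (x - 4) * (z - 4) + 4 * (x + y + z - t - 4) := by
    by_cases hK5 : 5 ≤ x + y + z - t
    · nlinarith [mul_nonneg (sub_nonneg.2 hx) (sub_nonneg.2 hz)]
    · have hx6 : 6 ≤ x := by nlinarith
      have hz6 : 6 ≤ z := by nlinarith
      nlinarith
  have hD : (2 * t - x * z) ^ 2 = x * z * ((x - 4) * (z - 4) + 4 * (x + y + z - t - 4)) := by
    linear_combination 4 * ht
  have h64 : 8 ^ 2 ≤ (2 * t - x * z) ^ 2 := by rw [hD]; nlinarith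
  have h8 : 8 ≤ 2 * t - x * z := by
    rwa [sq_le_sq₀ (by norm_num) (by linarith)] at h64
  rw [abs_le]
  constructor <;> linarith

/-- As a function of the largest variable `b`, `K` decreases on `[a, ac/2]`. Comparison with its
value at `b = a` gives `(c - 2)(c + 2 - a²) ≥ 0`, which forces `c = 2` and `a = b`. Then `abc - a² -
b² = 0`, contrary to `h1`. -/
lemma reducible_of_sorted {a b c : ℝ} (hc : 2 ≤ c) (hca : c ≤ a) (hab : a ≤ b)
    (hb : 2 * b ≤ a * c) (hK : 4 ≤ a ^ 2 + b ^ 2 + c ^ 2 - a * b * c)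
    (h1 : 4 ≤ (a * b * c - a ^ 2 - b ^ 2) ^ 2) : False := by
  have e1 : a ^ 2 + b ^ 2 + c ^ 2 - a * b * c ≤ 2 * a ^ 2 + c ^ 2 - a ^ 2 * c := by
    nlinarith [mul_nonneg (sub_nonneg.2 hab) (by linarith : 0 ≤ a * c - b - a)]
  have e2 : 0 ≤ (c - 2) * (c + 2 - a ^ 2) := by linarith
  have e3 : c = 2 := by
    by_contra hne
    have : 0 < c - 2 := by
      rcases hc.eq_or_lt with h | h
      · exact absurd h.symm hne
      · linarith
    have : 0 ≤ c + 2 - a ^ 2 := nonneg_of_mul_nonneg_right e2 this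
    nlinarith
  subst e3
  have : a = b := by linarith
  subst this
  nlinarith

lemma HasTriple.reducible (h : HasTriple Γ x y z t) (hx : 4 ≤ x) (hy : 4 ≤ y) (hz : 4 ≤ z)
    (hK : 4 ≤ x + y + z - t) (h1 : 4 ≤ (t - y - z) ^ 2) (h2 : 4 ≤ (t - x - z) ^ 2)
    (h3 : 4 ≤ (t - x - y) ^ 2) (hxz : 2 * t ≤ x * z) (hxy : 2 * t ≤ x * y) : y * z < 2 * t := by
  by_contra! hyz
  obtain ⟨u, v, w, -, rfl, rfl, rfl, rfl⟩ := h
  rw [abs_mul, abs_mul] at *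
  rw [← sq_abs (symp u v), ← sq_abs (symp v w), ← sq_abs (symp u w)] at *
  have two : ∀ r : ℝ, 4 ≤ |r| ^ 2 → 2 ≤ |r| := fun r hr =>
    (sq_le_sq₀ (by norm_num) (abs_nonneg r)).1 (by linarith)
  have ha := two _ hx
  have hb := two _ hy
  have hc := two _ hz
  generalize |symp u v| = a at *
  generalize |symp v w| = b at *
  generalize |symp u w| = c at *
  have cancel : ∀ p q r : ℝ, 2 ≤ p → 2 ≤ q → 2 * (p * r * q) ≤ p ^ 2 * q ^ 2 → 2 * r ≤ p * q := by
    intro p q r hp hq h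
    have : 0 < p * q := by positivity
    exact le_of_mul_le_mul_right (by nlinarith) this
  have ib := cancel a c b ha hc hxz
  have ic := cancel a b c ha hb (by linarith)
  have ia := cancel b c a hb hc (by linarith)
  rcases le_total a b with hab | hab <;> rcases le_total b c with hbc | hbc <;>
    rcases le_total a c with hac | hac
  · exact reducible_of_sorted (a := b) (b := c) (c := a) ha hab hbc (by linarith) (by linarith)
      (by convert h1 using 2; ring)
  · exact reducible_of_sorted (a := b) (b := c) (c := a) ha hab hbc (by linarith) (by linarith)
      (by convert h1 using 2; ring)
  · exact reducible_of_sorted (a := c) (b := b) (c := a) ha hac hbc (by linarith) (by linarith)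
      (by convert h1 using 2; ring)
  · exact reducible_of_sorted (a := a) (b := b) (c := c) hc hac hab (by linarith) (by linarith)
      (by convert h3 using 2)
  · exact reducible_of_sorted (a := a) (b := c) (c := b) hb hab hac (by linarith) (by linarith)
      (by convert h2 using 2; ring)
  · exact reducible_of_sorted (a := c) (b := a) (c := b) hb hbc hac (by linarith) (by linarith)
      (by convert h2 using 2; ring)
  · exact reducible_of_sorted (a := a) (b := c) (c := b) hb hab hac (by linarith) (by linarith)
      (by convert h2 using 2; ring)
  · exact reducible_of_sorted (a := b) (b := a) (c := c) hc hbc hab (by linarith) (by linarith)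
      (by convert h3 using 2; ring)

end triple

/-! ### Parabolic matrices -/

/-- The nilpotent part of a parabolic matrix, as a function of the entries: the matrix is
multiplied by the sign that makes its trace positive, and the identity is subtracted. -/
noncomputable def nilPart (m : Fin 2 → Fin 2 → ℝ) (i j : Fin 2) : ℝ :=
  (m 0 0 + m 1 1) / 2 * m i j - if i = j then 1 else 0

/-- A symmetric matrix of determinant zero is `± v vᵀ`; `s` is that sign and `σ` the relative sign
of the two coordinates. -/
lemma exists_vector_of_nilpotent {p q r : ℝ} (h : p ^ 2 = q * r) :
    ∃ (s : ℝ) (v : Fin 2 → ℝ), (s = 1 ∨ s = -1) ∧ p = s * (v 0 * v 1) ∧ q = s * v 0 ^ 2 ∧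
      r = s * v 1 ^ 2 := by
  obtain ⟨s, hs, hq, hr⟩ : ∃ s : ℝ, (s = 1 ∨ s = -1) ∧ 0 ≤ s * q ∧ 0 ≤ s * r := by
    have h0 : 0 ≤ q * r := h ▸ sq_nonneg p
    rcases mul_nonneg_iff.1 h0 with ⟨h1, h2⟩ | ⟨h1, h2⟩
    · exact ⟨1, .inl rfl, by linarith, by linarith⟩
    · exact ⟨-1, .inr rfl, by linarith, by linarith⟩
  have hs2 : s * s = 1 := by rcases hs with rfl | rfl <;> norm_num
  have hsqrt : √(s * q) * √(s * r) = |p| := by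
    rw [← Real.sqrt_mul hq, ← Real.sqrt_sq_eq_abs, h]
    congr 1
    linear_combination q * r * hs2
  obtain ⟨σ, hσ, hσp⟩ : ∃ σ : ℝ, σ * σ = 1 ∧ σ * |p| = s * p := by
    rcases abs_choice p with hp | hp
    · exact ⟨s, hs2, by rw [hp]⟩
    · exact ⟨-s, by linarith, by rw [hp]; ring⟩
  refine ⟨s, ![√(s * q), σ * √(s * r)], hs, ?_, ?_, ?_⟩
  · simp only [Matrix.cons_val_zero, Matrix.cons_val_one]
    linear_combination (-s * σ) * hsqrt - s * hσp - p * hs2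
  · simp only [Matrix.cons_val_zero]
    rw [Real.sq_sqrt hq]
    linear_combination (-q) * hs2
  · simp only [Matrix.cons_val_one, Matrix.cons_val_zero]
    rw [mul_pow, Real.sq_sqrt hr]
    linear_combination (-r) * hs2 - s * (s * r) * hσ

lemma parabolic_eq_transv (m : SL(2, ℝ)) (h : PSLParabolic (m : PSL(2, ℝ))) :
    ∃ (s : ℝ) (v : Fin 2 → ℝ), (s = 1 ∨ s = -1) ∧
      (m : PSL(2, ℝ)) = (transv s v : SL(2, ℝ)) ∧
      nilPart (fun i j => m i j) 0 0 = -(s * (v 0 * v 1)) ∧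
      nilPart (fun i j => m i j) 0 1 = s * v 0 ^ 2 ∧
      nilPart (fun i j => m i j) 1 0 = -(s * v 1 ^ 2) ∧
      nilPart (fun i j => m i j) 1 1 = s * (v 0 * v 1) := by
  obtain ⟨m', hm', -, hdisc'⟩ := h
  rw [Matrix.discr_fin_two, Matrix.SpecialLinearGroup.det_coe, Matrix.trace_fin_two] at hdisc'
  have hdisc : (m 0 0 + m 1 1) ^ 2 = 4 := by
    rcases (PSL_eq_iff m' m).1 hm' with rfl | rfl
    · linarith
    · simp only [Matrix.SpecialLinearGroup.coe_neg, Matrix.neg_apply]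
      linarith
  have hdet := SL2_det m
  -- Half the trace is `±1`; multiplying by it makes the matrix unipotent.
  obtain ⟨τ, hτ⟩ : ∃ τ, (m 0 0 + m 1 1) / 2 = τ := ⟨_, rfl⟩
  have hτ2 : τ * τ = 1 := by rw [← hτ]; linarith
  have hsum : m 0 0 + m 1 1 = 2 * τ := by linarith
  obtain ⟨s, v, hs, h1, h2, h3⟩ := exists_vector_of_nilpotent
    (p := τ * m 1 1 - 1) (q := τ * m 0 1) (r := -(τ * m 1 0))
    (by linear_combination (-τ ^ 2) * hdet + τ ^ 2 * m 1 1 * hsum + (2 * τ * m 1 1 - 1) * hτ2)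
  refine ⟨s, v, hs, ?_, ?_, ?_, ?_, ?_⟩
  · have hm : ∀ i j, m i j = τ * transv s v i j := by
      intro i j
      fin_cases i <;> fin_cases j <;>
        simp only [Fin.zero_eta, Fin.mk_one, transv_00, transv_01, transv_10, transv_11]
      · linear_combination hsum + m 1 1 * hτ2 - τ * h1
      · linear_combination (-m 0 1) * hτ2 + τ * h2
      · linear_combination (-m 1 0) * hτ2 - τ * h3
      · linear_combination (-m 1 1) * hτ2 + τ * h1
    rw [PSL_eq_iff]
    have h4 : (τ - 1) * (τ + 1) = 0 := by linarith
    rcases mul_eq_zero.1 h4 with h5 | h5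
    · left
      ext i j
      rw [hm, show τ = 1 by linarith, one_mul]
    · right
      ext i j
      rw [Matrix.SpecialLinearGroup.coe_neg, Matrix.neg_apply, hm, show τ = -1 by linarith]
      ring
  all_goals simp only [nilPart, hτ, Fin.isValue, zero_ne_one, one_ne_zero, if_true, if_false]
  · linear_combination τ * hsum + 2 * hτ2 - h1
  · linarith
  · linarith
  · linarith

/-- The trace of the product of two `2 × 2` matrices. -/
def traceTwo (p q : Fin 2 → Fin 2 → ℝ) : ℝ :=
  p 0 0 * q 0 0 + p 0 1 * q 1 0 + (p 1 0 * q 0 1 + p 1 1 * q 1 1)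

/-- The trace of the product of three `2 × 2` matrices. -/
def traceThree (p q r : Fin 2 → Fin 2 → ℝ) : ℝ :=
  (p 0 0 * q 0 0 + p 0 1 * q 1 0) * r 0 0 + (p 0 0 * q 0 1 + p 0 1 * q 1 1) * r 1 0 +
    ((p 1 0 * q 0 0 + p 1 1 * q 1 0) * r 0 1 + (p 1 0 * q 0 1 + p 1 1 * q 1 1) * r 1 1)

lemma mem_of_eq_transv {Γ : Subgroup PSL(2, ℝ)} {s : ℝ} (hs : s = 1 ∨ s = -1) (v : Fin 2 → ℝ) :
    ((transv s v : SL(2, ℝ)) : PSL(2, ℝ)) ∈ Γ ↔ ptransv v ∈ Γ := by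
  rcases hs with rfl | rfl
  · rfl
  · have : ((transv (-1) v : SL(2, ℝ)) : PSL(2, ℝ)) = (ptransv v)⁻¹ := by
      rw [← transv_inv]; rfl
    rw [this, inv_mem_iff]

/-- The nilpotent parts satisfy `tr(N_u N_v) = -r s ω(u, v)²` and `tr(N_u N_v N_w) = -r s t abc`,
with `r`, `s`, `t` equal to `±1`. Absolute values remove the signs. -/
lemma hasTriple_of_parabolic (a b c : SL(2, ℝ)) (ha : PSLParabolic (a : PSL(2, ℝ)))
    (hb : PSLParabolic (b : PSL(2, ℝ))) (hc : PSLParabolic (c : PSL(2, ℝ))) :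
    HasTriple (Subgroup.closure {(a : PSL(2, ℝ)), (b : PSL(2, ℝ)), (c : PSL(2, ℝ))})
      |traceTwo (nilPart fun i j => a i j) (nilPart fun i j => b i j)|
      |traceTwo (nilPart fun i j => b i j) (nilPart fun i j => c i j)|
      |traceTwo (nilPart fun i j => a i j) (nilPart fun i j => c i j)|
      |traceThree (nilPart fun i j => a i j) (nilPart fun i j => b i j)
        (nilPart fun i j => c i j)| := by
  obtain ⟨r, u, hr, hau, a00, a01, a10, a11⟩ := parabolic_eq_transv a ha
  obtain ⟨s, v, hs, hbv, b00, b01, b10, b11⟩ := parabolic_eq_transv b hb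
  obtain ⟨t, w, ht, hcw, c00, c01, c10, c11⟩ := parabolic_eq_transv c hc
  have habs : ∀ {r : ℝ}, (r = 1 ∨ r = -1) → |r| = 1 := by
    rintro r (rfl | rfl) <;> simp
  have htwo : ∀ (r s : ℝ) (u v : Fin 2 → ℝ), |r| = 1 → |s| = 1 →
      |-(r * s * symp u v ^ 2)| = symp u v ^ 2 := by
    intro r s u v hr hs
    rw [abs_neg, abs_mul, abs_mul, hr, hs, one_mul, one_mul, abs_of_nonneg (sq_nonneg _)]
  refine ⟨u, v, w, ?_, ?_, ?_, ?_, ?_⟩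
  · rw [hau, hbv, hcw]
    apply le_antisymm <;> rw [Subgroup.closure_le] <;> rintro x (rfl | rfl | rfl)
    · exact (mem_of_eq_transv hr u).2 (Subgroup.subset_closure (by simp))
    · exact (mem_of_eq_transv hs v).2 (Subgroup.subset_closure (by simp))
    · exact (mem_of_eq_transv ht w).2 (Subgroup.subset_closure (by simp))
    · exact (mem_of_eq_transv hr u).1 (Subgroup.subset_closure (by simp))
    · exact (mem_of_eq_transv hs v).1 (Subgroup.subset_closure (by simp))
    · exact (mem_of_eq_transv ht w).1 (Subgroup.subset_closure (by simp))
  · rw [← htwo r s u v (habs hr) (habs hs)]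
    simp only [traceTwo, a00, a01, a10, a11, b00, b01, b10, b11, symp]
    congr 1; ring
  · rw [← htwo s t v w (habs hs) (habs ht)]
    simp only [traceTwo, c00, c01, c10, c11, b00, b01, b10, b11, symp]
    congr 1; ring
  · rw [← htwo r t u w (habs hr) (habs ht)]
    simp only [traceTwo, a00, a01, a10, a11, c00, c01, c10, c11, symp]
    congr 1; ring
  · have : |symp u v * symp v w * symp u w| =
        |-(r * s * t * (symp u v * symp v w * symp u w))| := by
      rw [abs_neg, abs_mul (r * s * t), abs_mul (r * s), abs_mul r, habs hr, habs hs, habs ht]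
      simp
    rw [this]
    simp only [traceThree, a00, a01, a10, a11, b00, b01, b10, b11, c00, c01, c10, c11, symp]
    congr 1; ring

/-! ### Reasoning about machines -/

namespace BSSMachine

variable {ι : Type} {M : BSSMachine ι}

/-- Started in the configuration `c`, the machine halts with an answer satisfying `Q`. -/
def HaltsFrom (M : BSSMachine ι) (Q : Bool → Prop) (c : M.Config) : Prop :=
  ∃ n : ℕ, ∃ answer, M.instr (M.step^[n] c).1 = .halt answer ∧ Q answer

variable {Q : Bool → Prop} {p : M.Node} {v : ι ⊕ M.Work → ℝ}

lemma HaltsFrom.of_step {c : M.Config} (h : M.HaltsFrom Q (M.step c)) : M.HaltsFrom Q c := by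
  obtain ⟨n, answer, h1, h2⟩ := h
  exact ⟨n + 1, answer, h1, h2⟩

lemma haltsFrom_halt {answer : Bool} (hp : M.instr p = .halt answer) (hQ : Q answer) :
    M.HaltsFrom Q (p, v) := ⟨0, answer, hp, hQ⟩

lemma haltsFrom_compute {f : ι ⊕ M.Work → ArithTerm (ι ⊕ M.Work)} {next : M.Node}
    (hp : M.instr p = .compute f next) (h : M.HaltsFrom Q (next, fun r => (f r).eval v)) :
    M.HaltsFrom Q (p, v) := by
  apply HaltsFrom.of_step
  simpa only [step, hp] using h

lemma haltsFrom_branch {t : ArithTerm (ι ⊕ M.Work)} {p₁ p₂ : M.Node}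
    (hp : M.instr p = .branch t p₁ p₂) (h₁ : 0 ≤ t.eval v → M.HaltsFrom Q (p₁, v))
    (h₂ : t.eval v < 0 → M.HaltsFrom Q (p₂, v)) : M.HaltsFrom Q (p, v) := by
  apply HaltsFrom.of_step
  by_cases ht : 0 ≤ t.eval v
  · simpa only [step, hp, if_pos ht] using h₁ ht
  · simpa only [step, hp, if_neg ht] using h₂ (not_le.1 ht)

lemma HaltsFrom.haltsWith {x : ι → ℝ} (h : M.HaltsFrom Q (M.init x)) :
    ∃ answer, M.HaltsWith x answer ∧ Q answer := by
  obtain ⟨n, answer, h1, h2⟩ := h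
  exact ⟨answer, ⟨n, h1⟩, h2⟩

lemma HaltsWith.unique {x : ι → ℝ} {a b : Bool} (ha : M.HaltsWith x a) (hb : M.HaltsWith x b) :
    a = b := by
  have key : ∀ (m : ℕ) (c : M.Config) (a : Bool), M.instr c.1 = .halt a → M.step^[m] c = c := by
    intro m c a hc
    apply Function.iterate_fixed
    simp only [step, hc]
  have main : ∀ {m n : ℕ} {a b : Bool}, m ≤ n → M.instr (M.step^[m] (M.init x)).1 = .halt a →
      M.instr (M.step^[n] (M.init x)).1 = .halt b → a = b := by
    intro m n a b hmn h1 h2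
    obtain ⟨k, rfl⟩ := Nat.exists_eq_add_of_le' hmn
    rw [Function.iterate_add_apply, key k _ a h1, h1] at h2
    exact BSSInstr.halt.inj h2
  obtain ⟨m, hm⟩ := ha
  obtain ⟨n, hn⟩ := hb
  rcases le_total m n with h | h
  · exact main h hm hn
  · exact (main h hn hm).symm

end BSSMachine

/-! ### The machine -/

/-- The nodes of the machine. -/
inductive TripleNode : Type
  | start
  | sign (i : Fin 4)
  | flip (i : Fin 4)
  | large (i : Fin 3)
  | accept
  | trace
  | conj (i : Fin 3)
  | choose (i : Fin 2)
  | reduce (i : Fin 3)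
  | answer (b : Bool)
  deriving DecidableEq, Fintype

/-- The registers: the twelve input registers and four work registers. -/
abbrev TripleReg : Type := (Fin 3 × Fin 2 × Fin 2) ⊕ Fin 4

namespace TripleTerm

/-- An input register. -/
abbrev entry (k : Fin 3) (i j : Fin 2) : ArithTerm TripleReg := .var (.inl (k, i, j))

/-- A work register. -/
abbrev work (i : Fin 4) : ArithTerm TripleReg := .var (.inr i)

/-- The term for `nilPart`. -/
def nil (k : Fin 3) (i j : Fin 2) : ArithTerm TripleReg :=
  .sub (.mul (.div (.add (entry k 0 0) (entry k 1 1)) (.const 2)) (entry k i j))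
    (.const (if i = j then 1 else 0))

/-- The term for `traceTwo`. -/
def two (k l : Fin 3) : ArithTerm TripleReg :=
  .add (.add (.mul (nil k 0 0) (nil l 0 0)) (.mul (nil k 0 1) (nil l 1 0)))
    (.add (.mul (nil k 1 0) (nil l 0 1)) (.mul (nil k 1 1) (nil l 1 1)))

/-- The term for an entry of a product of two matrices. -/
def prod (k l : Fin 3) (i j : Fin 2) : ArithTerm TripleReg :=
  .add (.mul (nil k i 0) (nil l 0 j)) (.mul (nil k i 1) (nil l 1 j))

/-- The term for `traceThree`. -/
def three (k l m : Fin 3) : ArithTerm TripleReg :=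
  .add (.add (.mul (prod k l 0 0) (nil m 0 0)) (.mul (prod k l 0 1) (nil m 1 0)))
    (.add (.mul (prod k l 1 0) (nil m 0 1)) (.mul (prod k l 1 1) (nil m 1 1)))

/-- The instruction assigning to the work registers the values of four terms. -/
def assign (f : Fin 4 → ArithTerm TripleReg) (r : TripleReg) : ArithTerm TripleReg :=
  Sum.elim (fun p => .var (.inl p)) f r

lemma eval_nil (v : TripleReg → ℝ) (k : Fin 3) (i j : Fin 2) :
    (nil k i j).eval v = nilPart (fun i j => v (.inl (k, i, j))) i j := by
  simp only [nil, ArithTerm.eval, nilPart]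
  norm_cast

lemma eval_two (v : TripleReg → ℝ) (k l : Fin 3) :
    (two k l).eval v = traceTwo (nilPart fun i j => v (.inl (k, i, j)))
      (nilPart fun i j => v (.inl (l, i, j))) := by
  simp only [two, ArithTerm.eval, eval_nil, traceTwo]

lemma eval_three (v : TripleReg → ℝ) (k l m : Fin 3) :
    (three k l m).eval v = traceThree (nilPart fun i j => v (.inl (k, i, j)))
      (nilPart fun i j => v (.inl (l, i, j))) (nilPart fun i j => v (.inl (m, i, j))) := by
  simp only [three, prod, ArithTerm.eval, eval_nil, traceThree]

/-- `p * q - 2 * t + r`. -/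
def mutate (p q r : Fin 4) : ArithTerm TripleReg :=
  .add (.sub (.mul (work p) (work q)) (.mul (.const 2) (work 3))) (work r)

/-- `p * q - t`. -/
def mutateProd (p q : Fin 4) : ArithTerm TripleReg := .sub (.mul (work p) (work q)) (work 3)

/-- `p * q - 2 * t`. -/
def excess (p q : Fin 4) : ArithTerm TripleReg :=
  .sub (.mul (work p) (work q)) (.mul (.const 2) (work 3))

/-- `(t - p - q) ^ 2 - 4`. -/
def conjGap (p q : Fin 4) : ArithTerm TripleReg :=
  .sub (.mul (.sub (.sub (work 3) (work p)) (work q)) (.sub (.sub (work 3) (work p)) (work q)))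
    (.const 4)

/-- `t - x - y - z`. -/
def margin : ArithTerm TripleReg := .sub (.sub (.sub (work 3) (work 0)) (work 1)) (work 2)

end TripleTerm

open TripleTerm in
/-- The flow chart. The work registers hold `x`, `y`, `z`, `t` as in `HasTriple`. -/
def tripleInstr : TripleNode → BSSInstr TripleReg TripleNode
  | .start => .compute (assign ![two 0 1, two 1 2, two 0 2, three 0 1 2]) (.sign 0)
  | .sign i => .branch (work i) (![.sign 1, .sign 2, .sign 3, .large 0] i) (.flip i)
  | .flip i => .compute (assign fun j => if j = i then .sub (.const 0) (work j) else work j)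
      (.sign i)
  | .large i => .branch (.sub (work i.castSucc) (.const 4)) (![.large 1, .large 2, .accept] i)
      (.answer false)
  | .accept => .branch margin (.answer true) .trace
  | .trace => .branch (.sub (.sub (.const 0) margin) (.const 4)) (.conj 0) (.answer false)
  | .conj i => .branch (conjGap (![1, 0, 0] i) (![2, 2, 1] i)) (![.conj 1, .conj 2, .choose 0] i)
      (.answer false)
  | .choose i => .branch (excess 0 (![2, 1] i)) (![.choose 1, .reduce 2] i)
      (![.reduce 0, .reduce 1] i)
  | .reduce i => .compute (assign (![
      ![work 0, mutate 0 2 1, work 2, mutateProd 0 2],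
      ![work 0, work 1, mutate 0 1 2, mutateProd 0 1],
      ![mutate 1 2 0, work 1, work 2, mutateProd 1 2]] i)) (.sign 3)
  | .answer b => .halt b

/-- The machine deciding discreteness. -/
def tripleMachine : BSSMachine (Fin 3 × Fin 2 × Fin 2) where
  Work := Fin 4
  finite_work := inferInstance
  Node := TripleNode
  finite_node := inferInstance
  start := .start
  instr := tripleInstr

/-! ### Correctness and termination of the machine. -/

open BSSMachine

lemma haltsFrom_sign {Q : Bool → Prop} (i : Fin 4) (v : TripleReg → ℝ)
    (h : ∀ v' : TripleReg → ℝ, v' (.inr i) = |v (.inr i)| →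
      (∀ j, j ≠ i → v' (.inr j) = v (.inr j)) →
      tripleMachine.HaltsFrom Q (![TripleNode.sign 1, .sign 2, .sign 3, .large 0] i, v')) :
    tripleMachine.HaltsFrom Q (TripleNode.sign i, v) := by
  refine haltsFrom_branch rfl (fun h0 => ?_) (fun h0 => ?_)
  · exact h v (abs_of_nonneg h0).symm fun _ _ => rfl
  · refine haltsFrom_compute rfl ?_
    have h1 : v (.inr i) < 0 := h0
    refine haltsFrom_branch rfl (fun h2 => ?_) (fun h2 => ?_)
    · refine h _ ?_ fun j hj => ?_
      · simp [TripleTerm.assign, ArithTerm.eval, abs_of_neg h1]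
      · simp [TripleTerm.assign, ArithTerm.eval, hj]
    · simp [TripleTerm.assign, ArithTerm.eval] at h2
      linarith

/-- The induction is on a bound for the number of passes: each reduction lowers `t` by at least `8`,
and `t ≥ 0`. -/
lemma haltsFrom_large {Γ : Subgroup PSL(2, ℝ)} (e : Nonempty (Γ ≃* FreeGroup (Fin 3))) (n : ℕ) :
    ∀ v : TripleReg → ℝ, v (.inr 3) < 8 * n →
      HasTriple Γ (v (.inr 0)) (v (.inr 1)) (v (.inr 2)) (v (.inr 3)) →
      tripleMachine.HaltsFrom (fun b => b = true ↔ DiscreteTopology Γ)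
        (TripleNode.large 0, v) := by
  induction n with
  | zero =>
    intro v hv h
    have := h.nonneg
    simp only [CharP.cast_eq_zero, mul_zero] at hv
    linarith
  | succ n ih =>
    intro v hv h
    have reject : ¬ DiscreteTopology Γ →
        tripleMachine.HaltsFrom (fun b => b = true ↔ DiscreteTopology Γ)
          (TripleNode.answer false, v) := fun hd =>
      haltsFrom_halt (answer := false) rfl (by simpa using hd)
    have next : ∀ f : Fin 4 → ArithTerm TripleReg,
        HasTriple Γ ((f 0).eval v) ((f 1).eval v) ((f 2).eval v) |(f 3).eval v| →
        |(f 3).eval v| ≤ v (.inr 3) - 8 →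
        tripleMachine.HaltsFrom (fun b => b = true ↔ DiscreteTopology Γ)
          (TripleNode.sign 3, fun r => (TripleTerm.assign f r).eval v) := by
      intro f hf hle
      refine haltsFrom_sign 3 _ fun v' h3 hj => ?_
      refine ih v' ?_ ?_
      · rw [h3]
        push_cast at hv
        change |(f 3).eval v| < _
        linarith
      · rw [h3, hj 0 (by decide), hj 1 (by decide), hj 2 (by decide)]
        exact hf
    refine haltsFrom_branch rfl (fun hx => ?_)
      (fun hx => reject (not_discreteTopology_of_lt_four e h ?_))
    swap
    · simpa [ArithTerm.eval] using hx
    refine haltsFrom_branch rfl (fun hy => ?_)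
      (fun hy => reject (not_discreteTopology_of_lt_four e h.rotate ?_))
    swap
    · simpa [ArithTerm.eval] using hy
    refine haltsFrom_branch rfl (fun hz => ?_)
      (fun hz => reject (not_discreteTopology_of_lt_four e h.rotate.rotate ?_))
    swap
    · simpa [ArithTerm.eval] using hz
    replace hx : 4 ≤ v (.inr 0) := by simpa [ArithTerm.eval] using hx
    replace hy : 4 ≤ v (.inr 1) := by simpa [ArithTerm.eval] using hy
    replace hz : 4 ≤ v (.inr 2) := by simpa [ArithTerm.eval] using hz
    refine haltsFrom_branch rfl (fun hK => ?_) (fun hK => ?_)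
    · simp only [TripleTerm.margin, ArithTerm.eval] at hK
      refine haltsFrom_halt (answer := true) rfl (iff_of_true rfl ?_)
      exact h.discreteTopology (by linarith) (by linarith) (by linarith) (by linarith)
    refine haltsFrom_branch rfl (fun hK4 => ?_) (fun hK4 => reject ?_)
    swap
    · simp only [TripleTerm.margin, ArithTerm.eval] at hK hK4
      push_cast at hK4
      exact not_discreteTopology_of_triple_trace e h (by linarith) (by linarith)
    replace hK : 4 ≤ v (.inr 0) + v (.inr 1) + v (.inr 2) - v (.inr 3) := by
      simp only [TripleTerm.margin, ArithTerm.eval] at hK4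
      push_cast at hK4
      linarith
    have conj : ∀ p q : Fin 4, (TripleTerm.conjGap p q).eval v =
        (v (.inr 3) - v (.inr p) - v (.inr q)) ^ 2 - 4 := by
      intro p q
      simp only [TripleTerm.conjGap, ArithTerm.eval]
      push_cast
      ring
    have gap : ∀ p q : Fin 4, (TripleTerm.conjGap p q).eval v < 0 →
        (v (.inr 3) - v (.inr p) - v (.inr q)) ^ 2 < 4 := fun p q h => by
      rw [conj] at h; linarith
    have gap' : ∀ p q : Fin 4, 0 ≤ (TripleTerm.conjGap p q).eval v →
        4 ≤ (v (.inr 3) - v (.inr p) - v (.inr q)) ^ 2 := fun p q h => by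
      rw [conj] at h; linarith
    refine haltsFrom_branch rfl (fun h1 => ?_)
      (fun h1 => reject (not_discreteTopology_of_conj e h (gap 1 2 h1)))
    refine haltsFrom_branch rfl (fun h2 => ?_)
      (fun h2 => reject (not_discreteTopology_of_conj e h.rotate.swap (gap 0 2 h2)))
    refine haltsFrom_branch rfl (fun h3 => ?_)
      (fun h3 => reject (not_discreteTopology_of_conj e h.rotate.rotate (gap 0 1 h3)))
    replace h1 := gap' 1 2 h1
    replace h2 := gap' 0 2 h2
    replace h3 := gap' 0 1 h3
    have hsq := h.sq_eq
    have hKs : 4 ≤ v (.inr 0) + v (.inr 2) + v (.inr 1) - v (.inr 3) := by linarith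
    have h1s : 4 ≤ (v (.inr 3) - v (.inr 2) - v (.inr 1)) ^ 2 := by linarith
    have hKr : 4 ≤ v (.inr 1) + v (.inr 0) + v (.inr 2) - v (.inr 3) := by linarith
    have h3r : 4 ≤ (v (.inr 3) - v (.inr 1) - v (.inr 0)) ^ 2 := by linarith
    have eval_mutate : ∀ p q r : Fin 4, (TripleTerm.mutate p q r).eval v =
        v (.inr p) * v (.inr q) - 2 * v (.inr 3) + v (.inr r) := by
      intro p q r
      simp only [TripleTerm.mutate, ArithTerm.eval]
      push_cast
      rfl
    have eval_excess : ∀ p q : Fin 4, (TripleTerm.excess p q).eval v =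
        v (.inr p) * v (.inr q) - 2 * v (.inr 3) := by
      intro p q
      simp only [TripleTerm.excess, ArithTerm.eval]
      push_cast
      rfl
    have lt_of_excess : ∀ p q : Fin 4, (TripleTerm.excess p q).eval v < 0 →
        v (.inr p) * v (.inr q) < 2 * v (.inr 3) := fun p q h => by
      rw [eval_excess] at h; linarith
    have le_of_excess : ∀ p q : Fin 4, 0 ≤ (TripleTerm.excess p q).eval v →
        2 * v (.inr 3) ≤ v (.inr p) * v (.inr q) := fun p q h => by
      rw [eval_excess] at h; linarith
    refine haltsFrom_branch rfl (fun hxz => ?_) (fun hxz => haltsFrom_compute rfl (next _ ?_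
      (reduce_le hx hz hK hsq h1 h3 (lt_of_excess 0 2 hxz))))
    swap
    · have := h.reduce
      rw [← eval_mutate] at this
      exact this
    refine haltsFrom_branch rfl (fun hxy => ?_) (fun hxy => haltsFrom_compute rfl (next _ ?_
      (reduce_le hx hy hKs h.swap.sq_eq h1s h2 (lt_of_excess 0 1 hxy))))
    swap
    · have := h.swap.reduce.swap
      rw [← eval_mutate] at this
      exact this
    -- Two moves have failed to lower `t`, so the third must do so; this is why the flow chart does
    -- not test it.
    have hyz := h.reducible hx hy hz hK h1 h2 h3 (le_of_excess 0 2 hxz) (le_of_excess 0 1 hxy)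
    refine haltsFrom_compute rfl (next _ ?_
      (reduce_le hy hz hKr h.rotate.swap.sq_eq h2 h3r hyz))
    have := h.rotate.swap.reduce.swap.rotate.rotate
    rw [← eval_mutate] at this
    exact this

lemma tripleMachine_haltsFrom (a b c : SL(2, ℝ)) (ha : PSLParabolic (a : PSL(2, ℝ)))
    (hb : PSLParabolic (b : PSL(2, ℝ))) (hc : PSLParabolic (c : PSL(2, ℝ)))
    {Γ : Subgroup PSL(2, ℝ)} (hΓ : Γ = Subgroup.closure {(a : PSL(2, ℝ)), ↑b, ↑c})
    (e : Nonempty (Γ ≃* FreeGroup (Fin 3))) :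
    tripleMachine.HaltsFrom (fun b => b = true ↔ DiscreteTopology Γ)
      (tripleMachine.init (matrixEntries a b c)) := by
  have h := hasTriple_of_parabolic a b c ha hb hc
  rw [← hΓ] at h
  refine haltsFrom_compute rfl ?_
  refine haltsFrom_sign 0 _ fun v₀ h00 h0 => ?_
  refine haltsFrom_sign 1 _ fun v₁ h11 h1 => ?_
  refine haltsFrom_sign 2 _ fun v₂ h22 h2 => ?_
  refine haltsFrom_sign 3 _ fun v₃ h33 h3 => ?_
  obtain ⟨n, hn⟩ := exists_nat_gt (v₃ (.inr 3) / 8)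
  refine haltsFrom_large e n v₃ (by linarith) ?_
  rw [h33, h2 3 (by decide), h1 3 (by decide), h0 3 (by decide),
    h3 2 (by decide), h22, h1 2 (by decide), h0 2 (by decide),
    h3 1 (by decide), h2 1 (by decide), h11, h0 1 (by decide),
    h3 0 (by decide), h2 0 (by decide), h1 0 (by decide), h00]
  change HasTriple Γ |(TripleTerm.two 0 1).eval (Sum.elim (matrixEntries a b c) fun _ => 0)|
    |(TripleTerm.two 1 2).eval (Sum.elim (matrixEntries a b c) fun _ => 0)|
    |(TripleTerm.two 0 2).eval (Sum.elim (matrixEntries a b c) fun _ => 0)|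
    |(TripleTerm.three 0 1 2).eval (Sum.elim (matrixEntries a b c) fun _ => 0)|
  rw [TripleTerm.eval_two, TripleTerm.eval_two, TripleTerm.eval_two, TripleTerm.eval_three]
  exact h

theorem mainTheorem1 :
    -- one machine for all inputs
    ∃ M : BSSMachine (Fin 3 × Fin 2 × Fin 2),
      ∀ (A B C : PSL(2, ℝ)) (Γ : Subgroup PSL(2, ℝ)),
        PSLParabolic A → PSLParabolic B → PSLParabolic C →
        Γ = Subgroup.closure {A, B, C} →
        PSLNonElementary Γ →
        Nonempty (Γ ≃* FreeGroup (Fin 3)) →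
        -- the input consists of arbitrary matrices representing `A`, `B`, `C`
        ∀ a b c : SL(2, ℝ),
          (a : PSL(2, ℝ)) = A → (b : PSL(2, ℝ)) = B → (c : PSL(2, ℝ)) = C →
          -- every answer is correct
          (∀ answer : Bool, M.HaltsWith (matrixEntries a b c) answer →
            (answer = true ↔ DiscreteTopology Γ)) ∧
          -- non-discreteness is detected
          (¬ DiscreteTopology Γ → M.HaltsWith (matrixEntries a b c) false) ∧
          -- the machine halts if there are no elliptic elements
          ((∀ g ∈ Γ, ¬ PSLElliptic g) → M.Halts (matrixEntries a b c)) := by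
  refine ⟨tripleMachine, ?_⟩
  rintro A B C Γ hA hB hC hΓ - e a b c rfl rfl rfl
  obtain ⟨answer, hans, hcorrect⟩ := (tripleMachine_haltsFrom a b c hA hB hC hΓ e).haltsWith
  refine ⟨fun answer' h => ?_, fun hd => ?_, fun _ => ⟨answer, hans⟩⟩
  · rw [BSSMachine.HaltsWith.unique h hans]
    exact hcorrect
  · have : answer = false := by
      rw [← Bool.not_eq_true]
      exact fun h => hd (hcorrect.1 h)
    rwa [this] at hans
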